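/- Let $r,m\ge 0$, let $A,R\in\mathbb{R}^{r\times r}$, $C\in\mathbb{R}^{m\times r}$, $\Sigma\in\mathbb{R}^{m\times m}$ with $R,\Sigma$ symmetric positive definite, put $S:=C'\Sigma^{-1}C$, and assume that $(A,C)$ is observable, i.e. the matrix with blocks $C,CA,\dots,CA^{r-1}$ stacked on each other has rank $r$. Write $\mathbb{M}_r$ for the real $r\times r$ matrices, $\mathbb{S}_r^+\subset\mathbb{M}_r$ for the symmetric positive semi-definite ones, $\|\cdot\|_2$ for the spectral norm, and $\mathrm{Ricc}(Q):=AQ+QA'-QSQ+R$. Then for each $Q\in\mathbb{S}_r^+$ the equation $\partial_t\phi_t(Q)=\mathrm{Ricc}(\phi_t(Q))$, $\phi_0(Q)=Q$, has a unique solution on $[0,\infty)$, it stays in $\mathbb{S}_r^+$, and $\partial_tE_t(Q)=(A-\phi_t(Q)S)E_t(Q)$, $E_0(Q)=\mathrm{Id}$, has a unique solution on $[0,\infty)$. There is a unique positive definite $P$ with $\mathrm{Ricc}(P)=0$. There is $\nu>0$ such that $$\|E_t(Q)\|_2\le\kappa_E(\|Q\|_2)\,e^{-2\nu t}\quad\text{for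 all } Q\in\mathbb{S}_r^+,\ t\ge0, \qquad(\ast)$$ for some finite non-decreasing function $\kappa_E$. Let $\mathcal{B}\subset\mathbb{M}_r$ be a (not necessarily unital) subring and $\pi:\mathbb{M}_r\to\mathbb{M}_r$ a linear map with $\pi(\mathbb{S}_r^+)\subset\mathbb{S}_r^+$, $\pi(\mathbb{M}_r)\subset\mathcal{B}$, $\pi(B)=B$ for all $B\in\mathcal{B}$, $(\pi(A),\pi(A'),\pi(S),\pi(R))=(A,A',S,R)$, and $$(H)_3\qquad \pi\big(B[Q-\pi(Q)]+[Q-\pi(Q)]B\big)=0\quad\text{for all } Q\in\mathbb{M}_r,\ B\in\mathcal{B}.$$ Then for each $Q\in\mathbb{S}_r^+$ the projected Riccati equation $$\partial_t\phi^\pi_t(Q)=[A-\pi(X)S]X+X[A-\pi(X)S]'+R+\pi(X)S\pi(X)\Big|_{X=\phi^\pi_t(Q)},\qquad \phi^\pi_0(Q)=Q,$$ has a unique solution on $[0,\infty)$, and it stays in $\mathbb{S}_r^+$. There is $P^\pi\in\mathbb{S}_r^+$ with $\phi^\pi_t(P^\pi)=P^\pi$ for all $t\ge0$; for every $t>0$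 it is the only fixed point of $\phi^\pi_t$ in $\mathbb{S}_r^+$; moreover $\pi(P^\pi)=P$, and $P^\pi=P$. For every $\nu>0$ satisfying $(\ast)$ for some finite non-decreasing $\kappa_E$, there is a finite function $\kappa_\phi$, non-decreasing in each argument and independent of $(\mathcal{B},\pi)$, with $$\|\phi_t(Q_2)-\phi_t(Q_1)\|_2\le\kappa_\phi(\|Q_1\|_2,\|Q_2\|_2)\,e^{-2\nu t}\|Q_2-Q_1\|_2\quad\text{for all } Q_1,Q_2\in\mathbb{S}_r^+,\ t\ge0,$$ and, for each such $(\mathcal{B},\pi)$, there are finite functions $\kappa:\mathbb{R}^2\to\mathbb{R}$ and $c:\mathbb{R}\to\mathbb{R}$ such that for all $Q,Q_1,Q_2\in\mathbb{S}_r^+$ and $t\ge0$ $$\|\phi^\pi_t(Q_2)-\phi^\pi_t(Q_1)\|_2\le\kappa(\|Q_1\|_2,\|Q_2\|_2)\,e^{-2\nu t}\big[\|\pi(Q_2)-\pi(Q_1)\|_2+e^{-2\nu t}\|Q_2-Q_1\|_2\big],$$ $$\|\pi(\phi^\pi_t(Q))-\phi^\pi_t(Q)\|_2\le\kappa(\|Q\|_2,\|\pi(Q)\|_2)\,e^{-4\nu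 t}\|\pi(Q)-Q\|_2,$$ $$\|\phi^\pi_t(Q)-\phi_t(\pi(Q))\|_2\le\kappa(\|Q\|_2,\|\pi(Q)\|_2)\,e^{-4\nu t}\|Q-\pi(Q)\|_2,$$ $$\|\phi^\pi_t(Q)-\phi_t(Q)\|_2\le e^{-2\nu t}\big[\kappa_\phi(\|Q\|_2,\|\pi(Q)\|_2)+\kappa(\|Q\|_2,\|\pi(Q)\|_2)\,e^{-2\nu t}\big]\|Q-\pi(Q)\|_2,$$ $$\|\phi^\pi_t(Q)-\phi_t(Q)\|_2\le c(\|Q\|_2)\,e^{-2\nu t}\|Q-\pi(Q)\|_2 .$$ -/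

import Mathlib

/-! Matrix norms below are the spectral norm `‖·‖₂` (the operator norm for the Euclidean norm),
brought in by the following scope. -/
open scoped Matrix.Norms.L2Operator

/-- Square real matrices of size `r`. -/
abbrev SqMat (r : ℕ) : Type := Matrix (Fin r) (Fin r) ℝ

/-- `X` solves `∂ₜ X = F t X`, `X 0 = Q` on the whole half line `[0, ∞)`. -/
def IsForwardSolution {r : ℕ} (F : ℝ → SqMat r → SqMat r) (Q : SqMat r) (X : ℝ → SqMat r) :
    Prop :=
  X 0 = Q ∧ ∀ t : ℝ, 0 ≤ t → HasDerivWithinAt X (F t (X t)) (Set.Ici 0) t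

open Classical in
/-- The solution started at `Q` of `∂ₜ X = F t X` on `[0, ∞)`
(an arbitrary solution if there are several, the constant `Q` if there is none). -/
noncomputable def odeFlow {r : ℕ} (F : ℝ → SqMat r → SqMat r) (Q : SqMat r) : ℝ → SqMat r :=
  if h : ∃ X : ℝ → SqMat r, IsForwardSolution F Q X then h.choose else fun _ => Q

/-- The initial value problem has exactly one solution on `[0, ∞)`, and it is `odeFlow F Q`. -/
def IsWellPosed {r : ℕ} (F : ℝ → SqMat r → SqMat r) (Q : SqMat r) : Prop :=
  IsForwardSolution F Q (odeFlow F Q) ∧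
    ∀ Y : ℝ → SqMat r, IsForwardSolution F Q Y → ∀ t : ℝ, 0 ≤ t → Y t = odeFlow F Q t

/-- The observability matrix: the blocks `C, C A, …, C A ^ (r - 1)` stacked on each other. -/
def observabilityMatrix {r m : ℕ} (A : SqMat r) (C : Matrix (Fin m) (Fin r) ℝ) :
    Matrix (Fin r × Fin m) (Fin r) ℝ :=
  Matrix.of fun p j => (C * A ^ (p.1 : ℕ)) p.2 j

/-- The Riccati drift `A Q + Q A' - Q S Q + R`. -/
def ricc {r : ℕ} (A R S Q : SqMat r) : SqMat r :=
  A * Q + Q * A.transpose - Q * S * Q + R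

/-- The projected Riccati drift
`(A - π(Q) S) Q + Q (A - π(Q) S)' + R + π(Q) S π(Q)`. -/
def riccProj {r : ℕ} (A R S : SqMat r) (π : SqMat r → SqMat r) (Q : SqMat r) : SqMat r :=
  (A - π Q * S) * Q + Q * (A - π Q * S).transpose + R + π Q * S * π Q

/-- The Riccati semigroup `φ_t(Q)`. -/
noncomputable def riccFlow {r : ℕ} (A R S : SqMat r) (t : ℝ) (Q : SqMat r) : SqMat r :=
  odeFlow (fun _ => ricc A R S) Q t

/-- The projected Riccati semigroup `φ^π_t(Q)`. -/
noncomputable def riccProjFlow {r : ℕ} (A R S : SqMat r) (π : SqMat r → SqMat r)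
    (t : ℝ) (Q : SqMat r) : SqMat r :=
  odeFlow (fun _ => riccProj A R S π) Q t

/-- The right-hand side `(A - φ_t(Q) S) E` of the equation of the transition matrices `E_t(Q)`. -/
noncomputable def transDrift {r : ℕ} (A R S Q : SqMat r) (t : ℝ) (E : SqMat r) : SqMat r :=
  (A - riccFlow A R S t Q * S) * E

/-- The transition matrix `E_t(Q)`: `∂ₜ E_t(Q) = (A - φ_t(Q) S) E_t(Q)`, `E_0(Q) = Id`. -/
noncomputable def transMat {r : ℕ} (A R S : SqMat r) (t : ℝ) (Q : SqMat r) : SqMat r :=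
  odeFlow (transDrift A R S Q) 1 t

/-- `ν` is a decay rate of the transition matrices:
`‖E_t(Q)‖₂ ≤ κ_E(‖Q‖₂) e^{-2νt}` with a finite non-decreasing function `κ_E`. -/
def IsTransitionRate {r : ℕ} (A R S : SqMat r) (ν : ℝ) : Prop :=
  ∃ κE : ℝ → ℝ, Monotone κE ∧ ∀ Q : SqMat r, Q.PosSemidef → ∀ t : ℝ, 0 ≤ t →
    ‖transMat A R S t Q‖ ≤ κE ‖Q‖ * Real.exp (-2 * ν * t)

/-- `π` is a positive linear projection onto the matrix ring `𝓑`, the matrices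
`A, A', S, R` are fixed by `π`, and the orthogonality property
`π (B [Q - π(Q)] + [Q - π(Q)] B) = 0` holds for all matrices `Q` and all `B ∈ 𝓑`. -/
structure IsOrthogonalProjectionModel {r : ℕ} (A R S : SqMat r)
    (𝓑 : NonUnitalSubring (SqMat r)) (π : SqMat r →ₗ[ℝ] SqMat r) : Prop where
  positive : ∀ Q : SqMat r, Q.PosSemidef → (π Q).PosSemidef
  map_mem : ∀ Q : SqMat r, π Q ∈ 𝓑
  map_eq : ∀ B ∈ 𝓑, π B = B
  map_A : π A = A
  map_At : π A.transpose = A.transpose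
  map_S : π S = S
  map_R : π R = R
  orthogonal : ∀ Q : SqMat r, ∀ B ∈ 𝓑, π (B * (Q - π Q) + (Q - π Q) * B) = 0

/-! The proof rests on explicit formulas for the two flows.

*The Riccati flow.* In the Hamiltonian system `∂ₜX = -Aᵀ X + S Y`, `∂ₜY = R X + A Y`, started at
`(1, Q)`, the derivative of `Xᵀ Y` is `Yᵀ S Y + Xᵀ R X ≥ 0`. This
keeps `X` invertible for all `t ≥ 0`, so that `φ_t(Q) = Y X⁻¹` exists globally and is positive
semidefinite, and `E_t(Q)` is the inverse transpose of `X` (`exists_riccati_solution`). Order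
properties come from a Lyapunov comparison along `X` (`posSemidef_of_lyapunov`), and differences
of trajectories from `φ_t(Q₂) - φ_t(Q₁) = E_t(Q₂) (Q₂ - Q₁) E_t(Q₁)ᵀ` (`riccFlow_sub`).

*The stationary matrix and the rate.* Observability makes a weighted Gramian `W` positive
definite, and large multiples of `W⁻¹` are supersolutions of the algebraic equation, hence upper
barriers for `φ_t(0)`. This trajectory increases, and its limit is `P` (`exists_stationary`). Any
trajectory is squeezed between `φ_t(0)` and `P + c e^{-εt} P`, so `U_t = φ_t(Q) - P` is controlled
by one fixed trajectory up to an exponentially small term. Completing the square in the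
derivative of `Eᵀ P⁻¹ E` leaves `-R + U S U` as the effective drift, and Grönwall gives a rate
independent of `Q` (`exists_transitionRate`).

*The projected flow.* The orthogonality property says that `π` is a map of Jordan modules over
`𝓑`. What is needed is `π (B X + X Bᵀ) = B π(X) + π(X) Bᵀ` for symmetric `X`, which also involves
commutators of `X` with skew elements of `𝓑`; those are handled by
`IsOrthogonalProjectionModel.map_adMat_of_skew`. It follows that `π` maps the projected flow to the
Riccati flow of `π(Q)`, and
`φ^π_t(Q) = φ_t(π(Q)) + E_t(π(Q)) (Q - π(Q)) E_t(π(Q))ᵀ` (`riccProjFlow_eq`).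
All estimates are read off from this formula, from the decay of `E_t`, and from
`E_t(Q₁) - E_t(Q₂) = E_t(Q₂) (Q₂ - Q₁) G` with a bounded Gramian `G` (`exists_transMat_sub`). -/

open scoped Matrix

namespace RiccatiStability

variable {r : ℕ}

/-! ### Quadratic forms and the spectral norm -/

lemma posSemidef_iff {M : SqMat r} :
    M.PosSemidef ↔ Mᵀ = M ∧ ∀ x : Fin r → ℝ, 0 ≤ x ⬝ᵥ M *ᵥ x := by
  rw [Matrix.posSemidef_iff_dotProduct_mulVec, Matrix.IsHermitian,
    Matrix.conjTranspose_eq_transpose_of_trivial]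
  simp

lemma transpose_eq_of_posSemidef {M : SqMat r} (h : M.PosSemidef) : Mᵀ = M :=
  (posSemidef_iff.1 h).1

lemma quad_nonneg {M : SqMat r} (h : M.PosSemidef) (x : Fin r → ℝ) : 0 ≤ x ⬝ᵥ M *ᵥ x :=
  (posSemidef_iff.1 h).2 x

lemma quad_pos {M : SqMat r} (h : M.PosDef) {x : Fin r → ℝ} (hx : x ≠ 0) :
    0 < x ⬝ᵥ M *ᵥ x := by
  simpa using (Matrix.posDef_iff_dotProduct_mulVec.1 h).2 hx

lemma quad_conj (M N : SqMat r) (x : Fin r → ℝ) :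
    x ⬝ᵥ (Mᵀ * N * M) *ᵥ x = (M *ᵥ x) ⬝ᵥ N *ᵥ (M *ᵥ x) := by
  rw [mul_assoc, ← Matrix.mulVec_mulVec, ← Matrix.mulVec_mulVec, Matrix.dotProduct_mulVec,
    Matrix.vecMul_transpose]

lemma posSemidef_transpose_mul_mul {N : SqMat r} (h : N.PosSemidef) (M : SqMat r) :
    (Mᵀ * N * M).PosSemidef := by
  simpa [Matrix.conjTranspose_eq_transpose_of_trivial] using h.conjTranspose_mul_mul_same M

lemma posSemidef_mul_mul_self {S U : SqMat r} (hS : S.PosSemidef) (hU : Uᵀ = U) :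
    (U * S * U).PosSemidef := by
  simpa [hU] using posSemidef_transpose_mul_mul hS U

lemma posSemidef_of_transpose_mul_mul {M N : SqMat r} (hM : IsUnit M.det)
    (h : (Mᵀ * N * M).PosSemidef) : N.PosSemidef := by
  have h1 := posSemidef_transpose_mul_mul h M⁻¹
  have h2 : (M⁻¹)ᵀ * (Mᵀ * N * M) * M⁻¹ = N := by
    have e1 : M * M⁻¹ = 1 := Matrix.mul_nonsing_inv M hM
    have e2 : (M⁻¹)ᵀ * Mᵀ = 1 := by rw [← Matrix.transpose_mul, e1, Matrix.transpose_one]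
    calc (M⁻¹)ᵀ * (Mᵀ * N * M) * M⁻¹ = ((M⁻¹)ᵀ * Mᵀ) * N * (M * M⁻¹) := by noncomm_ring
      _ = N := by rw [e1, e2]; simp
  rwa [h2] at h1

lemma dotProduct_self_eq_norm_sq (x : Fin r → ℝ) :
    x ⬝ᵥ x = ‖(WithLp.toLp 2 x : EuclideanSpace ℝ (Fin r))‖ ^ 2 := by
  rw [EuclideanSpace.real_norm_sq_eq]
  simp [dotProduct, sq]

lemma dotProduct_self_nonneg' (x : Fin r → ℝ) : 0 ≤ x ⬝ᵥ x := by
  rw [dotProduct_self_eq_norm_sq]; positivity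

lemma dotProduct_mulVec_self_le (M : SqMat r) (x : Fin r → ℝ) :
    (M *ᵥ x) ⬝ᵥ (M *ᵥ x) ≤ ‖M‖ ^ 2 * (x ⬝ᵥ x) := by
  have h := Matrix.l2_opNorm_mulVec M (WithLp.toLp 2 x)
  rw [dotProduct_self_eq_norm_sq, dotProduct_self_eq_norm_sq, ← mul_pow]
  exact pow_le_pow_left₀ (norm_nonneg _) h 2

lemma norm_le_of_dotProduct_mulVec_self_le {M : SqMat r} {c : ℝ} (hc : 0 ≤ c)
    (h : ∀ x, (M *ᵥ x) ⬝ᵥ (M *ᵥ x) ≤ c ^ 2 * (x ⬝ᵥ x)) : ‖M‖ ≤ c := by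
  rw [Matrix.l2_opNorm_def]
  refine ContinuousLinearMap.opNorm_le_bound _ hc fun x => ?_
  have h1 := h x.ofLp
  rw [dotProduct_self_eq_norm_sq, dotProduct_self_eq_norm_sq, ← mul_pow] at h1
  exact le_of_sq_le_sq h1 (by positivity)

lemma abs_quad_le (M : SqMat r) (x : Fin r → ℝ) : |x ⬝ᵥ M *ᵥ x| ≤ ‖M‖ * (x ⬝ᵥ x) := by
  have h1 := dotProduct_mulVec_self_le M x
  have h2 : x ⬝ᵥ M *ᵥ x = inner ℝ (WithLp.toLp 2 (M *ᵥ x) : EuclideanSpace ℝ (Fin r))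
      (WithLp.toLp 2 x) := by
    simp [PiLp.inner_apply, dotProduct]
  rw [h2, dotProduct_self_eq_norm_sq]
  refine (abs_real_inner_le_norm _ _).trans ?_
  rw [sq, ← mul_assoc]
  exact mul_le_mul_of_nonneg_right (Matrix.l2_opNorm_mulVec M (WithLp.toLp 2 x)) (norm_nonneg _)

lemma quad_le (M : SqMat r) (x : Fin r → ℝ) : x ⬝ᵥ M *ᵥ x ≤ ‖M‖ * (x ⬝ᵥ x) :=
  (le_abs_self _).trans (abs_quad_le M x)

lemma dotProduct_mulVec_comm {M : SqMat r} (h : Mᵀ = M) (x y : Fin r → ℝ) :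
    x ⬝ᵥ M *ᵥ y = y ⬝ᵥ M *ᵥ x := by
  rw [Matrix.dotProduct_mulVec, dotProduct_comm, ← Matrix.mulVec_transpose, h]

/-- The Cauchy–Schwarz inequality for the form of a positive semidefinite matrix. -/
lemma dotProduct_mulVec_sq_le {M : SqMat r} (h : M.PosSemidef) (x y : Fin r → ℝ) :
    (x ⬝ᵥ M *ᵥ y) ^ 2 ≤ (x ⬝ᵥ M *ᵥ x) * (y ⬝ᵥ M *ᵥ y) := by
  have key : ∀ t : ℝ, 0 ≤ (y ⬝ᵥ M *ᵥ y) * (t * t) + (2 * (x ⬝ᵥ M *ᵥ y)) * t + x ⬝ᵥ M *ᵥ x := by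
    intro t
    have h1 := quad_nonneg h (x + t • y)
    have h2 := dotProduct_mulVec_comm (transpose_eq_of_posSemidef h) x y
    simp only [Matrix.mulVec_add, Matrix.mulVec_smul, dotProduct_add, add_dotProduct,
      dotProduct_smul, smul_dotProduct, smul_eq_mul] at h1
    rw [← h2] at h1
    linarith
  have h3 := discrim_le_zero key
  rw [discrim] at h3
  nlinarith

/-- A positive semidefinite matrix below `c • 1` has spectral norm at most `c`. -/
lemma norm_le_of_quad_le {M : SqMat r} (h : M.PosSemidef) {c : ℝ} (hc : 0 ≤ c)
    (hle : ∀ x, x ⬝ᵥ M *ᵥ x ≤ c * (x ⬝ᵥ x)) : ‖M‖ ≤ c := by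
  refine norm_le_of_dotProduct_mulVec_self_le hc fun x => ?_
  set y := M *ᵥ x with hy
  have h1 := dotProduct_mulVec_sq_le h y x
  rw [← hy] at h1
  have h2 : (y ⬝ᵥ y) ^ 2 ≤ (c * (y ⬝ᵥ y)) * (c * (x ⬝ᵥ x)) :=
    h1.trans (mul_le_mul (hle y) (hy ▸ hle x) (hy ▸ quad_nonneg h x)
      (mul_nonneg hc (dotProduct_self_nonneg' y)))
  rcases (dotProduct_self_nonneg' y).eq_or_lt with h0 | h0
  · rw [← h0]; exact mul_nonneg (sq_nonneg _) (dotProduct_self_nonneg' x)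
  · refine le_of_mul_le_mul_left ?_ h0
    nlinarith

lemma norm_le_norm_of_posSemidef_sub {M N : SqMat r} (hM : M.PosSemidef)
    (h : (N - M).PosSemidef) : ‖M‖ ≤ ‖N‖ := by
  refine norm_le_of_quad_le hM (norm_nonneg _) fun x => ?_
  have h1 := quad_nonneg h x
  rw [Matrix.sub_mulVec, dotProduct_sub] at h1
  linarith [quad_le N x]

lemma exists_pos_dotProduct_le_quad {M : SqMat r} (h : M.PosDef) :
    ∃ c : ℝ, 0 < c ∧ ∀ x, x ⬝ᵥ x ≤ c * (x ⬝ᵥ M *ᵥ x) := by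
  refine ⟨‖M⁻¹‖ + 1, by positivity, fun x => ?_⟩
  have hu : IsUnit M.det := (Matrix.isUnit_iff_isUnit_det M).1 h.isUnit
  have e1 : M *ᵥ (M⁻¹ *ᵥ x) = x := by
    rw [Matrix.mulVec_mulVec, Matrix.mul_nonsing_inv M hu, Matrix.one_mulVec]
  have h1 := dotProduct_mulVec_sq_le h.posSemidef x (M⁻¹ *ᵥ x)
  have h2 : (M⁻¹ *ᵥ x) ⬝ᵥ x ≤ ‖M⁻¹‖ * (x ⬝ᵥ x) := by
    rw [dotProduct_comm]; exact quad_le _ _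
  rw [e1] at h1
  have h3 := quad_nonneg h.posSemidef x
  have h4 : (x ⬝ᵥ x) ^ 2 ≤ (x ⬝ᵥ M *ᵥ x) * (‖M⁻¹‖ * (x ⬝ᵥ x)) :=
    h1.trans (mul_le_mul_of_nonneg_left h2 h3)
  rcases (dotProduct_self_nonneg' x).eq_or_lt with h0 | h0
  · rw [← h0]; positivity
  · refine le_of_mul_le_mul_left ?_ h0
    nlinarith

lemma norm_transpose (M : SqMat r) : ‖Mᵀ‖ = ‖M‖ := by
  rw [← Matrix.conjTranspose_eq_transpose_of_trivial, Matrix.l2_opNorm_conjTranspose]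

lemma eq_zero_of_dotProduct_self {x : Fin r → ℝ} (h : x ⬝ᵥ x = 0) : x = 0 :=
  dotProduct_self_eq_zero.1 h

/-! ### Calculus of matrix-valued functions -/

lemma hasDerivWithinAt_linear {E F : Type*} [NormedAddCommGroup E] [NormedSpace ℝ E]
    [FiniteDimensional ℝ E] [NormedAddCommGroup F] [NormedSpace ℝ F] (L : E →ₗ[ℝ] F)
    {X : ℝ → E} {X' : E} {s : Set ℝ} {t : ℝ} (h : HasDerivWithinAt X X' s t) :
    HasDerivWithinAt (fun u => L (X u)) (L X') s t :=
  (LinearMap.toContinuousLinearMap L).hasFDerivAt.comp_hasDerivWithinAt t h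

lemma hasDerivWithinAt_transpose {X : ℝ → SqMat r} {X' : SqMat r} {s : Set ℝ} {t : ℝ}
    (h : HasDerivWithinAt X X' s t) : HasDerivWithinAt (fun u => (X u)ᵀ) X'ᵀ s t :=
  hasDerivWithinAt_linear (Matrix.transposeLinearEquiv (Fin r) (Fin r) ℝ ℝ).toLinearMap h

/-- The quadratic form at a fixed vector, as a linear functional of the matrix. -/
def quadLin (x : Fin r → ℝ) : SqMat r →ₗ[ℝ] ℝ where
  toFun M := x ⬝ᵥ M *ᵥ x
  map_add' M N := by rw [Matrix.add_mulVec, dotProduct_add]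
  map_smul' c M := by simp [Matrix.smul_mulVec, dotProduct_smul]

lemma hasDerivWithinAt_quad {X : ℝ → SqMat r} {X' : SqMat r} {s : Set ℝ} {t : ℝ}
    (h : HasDerivWithinAt X X' s t) (x : Fin r → ℝ) :
    HasDerivWithinAt (fun u => x ⬝ᵥ X u *ᵥ x) (x ⬝ᵥ X' *ᵥ x) s t :=
  hasDerivWithinAt_linear (quadLin x) h

lemma hasDerivWithinAt_inv {X : ℝ → SqMat r} {X' : SqMat r} {s : Set ℝ} {t : ℝ}
    (h : HasDerivWithinAt X X' s t) (hu : IsUnit (X t).det) :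
    HasDerivWithinAt (fun u => (X u)⁻¹) (-((X t)⁻¹ * X' * (X t)⁻¹)) s t := by
  obtain ⟨u, hu'⟩ := (Matrix.isUnit_iff_isUnit_det (X t)).2 hu
  have h1 := hasFDerivAt_ringInverse (𝕜 := ℝ) u
  rw [hu'] at h1
  have h2 := h1.comp_hasDerivWithinAt t h
  have h3 : ((u⁻¹ : (SqMat r)ˣ) : SqMat r) = (X t)⁻¹ := by
    rw [← hu', Matrix.coe_units_inv]
  simp only [h3, Function.comp_def] at h2
  simpa [Matrix.nonsing_inv_eq_ringInverse] using h2

lemma monotoneOn_of_hasDerivWithinAt_Ici {f f' : ℝ → ℝ}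
    (h : ∀ t, 0 ≤ t → HasDerivWithinAt f (f' t) (Set.Ici 0) t) (h0 : ∀ t, 0 ≤ t → 0 ≤ f' t) :
    MonotoneOn f (Set.Ici 0) := by
  refine monotoneOn_of_hasDerivWithinAt_nonneg (f' := f') (convex_Ici 0)
    (fun t ht => (h t ht).continuousWithinAt) (fun t ht => ?_) (fun t ht => ?_)
  · exact (h t (interior_subset ht)).mono interior_subset
  · exact h0 t (interior_subset ht)

/-- Grönwall uniqueness: a curve starting at `0` whose speed is at most `k t` times its norm,
with `k` continuous, vanishes. -/
lemma eq_zero_of_norm_deriv_le {E : Type*} [NormedAddCommGroup E] [NormedSpace ℝ E]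
    {f f' : ℝ → E} {k : ℝ → ℝ} (hk : ContinuousOn k (Set.Ici 0))
    (h : ∀ t, 0 ≤ t → HasDerivWithinAt f (f' t) (Set.Ici 0) t)
    (hle : ∀ t, 0 ≤ t → ‖f' t‖ ≤ k t * ‖f t‖) (h0 : f 0 = 0) {t : ℝ} (ht : 0 ≤ t) :
    f t = 0 := by
  obtain ⟨K, hK⟩ := (isCompact_Icc (a := (0 : ℝ)) (b := t)).bddAbove_image
    (hk.mono Set.Icc_subset_Ici_self)
  have := norm_le_gronwallBound_of_norm_deriv_right_le (f := f) (f' := f') (δ := 0) (K := K)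
    (ε := 0) (a := 0) (b := t)
    (fun s hs => (h s hs.1).continuousWithinAt.mono Set.Icc_subset_Ici_self)
    (fun s hs => (h s hs.1).mono (Set.Ici_subset_Ici.2 hs.1)) (by simp [h0])
    (fun s hs => by
      rw [add_zero]
      exact (hle s hs.1).trans (mul_le_mul_of_nonneg_right
        (hK ⟨s, ⟨hs.1, hs.2.le⟩, rfl⟩) (norm_nonneg _)))
    t ⟨ht, le_rfl⟩
  rw [gronwallBound_ε0_δ0] at this
  exact norm_le_zero_iff.1 this

/-! ### Forward solutions and flows -/

lemma IsForwardSolution.continuousOn {F : ℝ → SqMat r → SqMat r} {Q : SqMat r}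
    {X : ℝ → SqMat r} (h : IsForwardSolution F Q X) : ContinuousOn X (Set.Ici 0) :=
  fun t ht => (h.2 t ht).continuousWithinAt

lemma isWellPosed_of_exists_unique {F : ℝ → SqMat r → SqMat r} {Q : SqMat r}
    (hex : ∃ X, IsForwardSolution F Q X)
    (huniq : ∀ X Y, IsForwardSolution F Q X → IsForwardSolution F Q Y →
      ∀ t : ℝ, 0 ≤ t → X t = Y t) : IsWellPosed F Q := by
  have h : IsForwardSolution F Q (odeFlow F Q) := by
    rw [odeFlow, dif_pos hex]; exact hex.choose_spec
  exact ⟨h, fun Y hY t ht => huniq Y _ hY h t ht⟩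

/-- Two solutions agree as soon as the difference of the drifts along them is bounded by a
continuous multiple of their distance. -/
lemma forwardSolution_unique {F : ℝ → SqMat r → SqMat r} {Q : SqMat r} {X Y : ℝ → SqMat r}
    (hX : IsForwardSolution F Q X) (hY : IsForwardSolution F Q Y) {k : ℝ → ℝ}
    (hk : ContinuousOn k (Set.Ici 0))
    (h : ∀ t, 0 ≤ t → ‖F t (X t) - F t (Y t)‖ ≤ k t * ‖X t - Y t‖) {t : ℝ} (ht : 0 ≤ t) :
    X t = Y t := by
  have := eq_zero_of_norm_deriv_le (f := fun u => X u - Y u) hk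
    (fun t ht => (hX.2 t ht).fun_sub (hY.2 t ht)) h (by simp [hX.1, hY.1]) ht
  exact sub_eq_zero.1 this

/-- Autonomous well-posed equations generate semigroups. -/
lemma odeFlow_add {F : SqMat r → SqMat r} {Q : SqMat r} {s t : ℝ} (hs : 0 ≤ s) (ht : 0 ≤ t)
    (hQ : IsWellPosed (fun _ => F) Q)
    (hQs : IsWellPosed (fun _ => F) (odeFlow (fun _ => F) Q s)) :
    odeFlow (fun _ => F) Q (t + s) = odeFlow (fun _ => F) (odeFlow (fun _ => F) Q s) t := by
  refine hQs.2 (fun u => odeFlow (fun _ => F) Q (u + s)) ⟨by simp, fun u hu => ?_⟩ t ht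
  have h1 := hQ.1.2 (u + s) (by positivity)
  have h2 : HasDerivWithinAt (fun u : ℝ => u + s) 1 (Set.Ici 0) u :=
    ((hasDerivAt_id u).add_const s).hasDerivWithinAt
  have h3 := h1.scomp u h2 (fun v (hv : 0 ≤ v) => show 0 ≤ v + s by positivity)
  simpa [Function.comp_def] using h3

/-- Lyapunov comparison. If `X` is the fundamental solution of the adjoint equation
`∂ₜX = -Bᵀ X` and `∂ₜV ≥ B V + V Bᵀ`, then `Xᵀ V X` is non-decreasing, so that `V` stays
positive semidefinite. -/
lemma posSemidef_of_lyapunov {B X V N : ℝ → SqMat r} (hX0 : X 0 = 1)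
    (hXu : ∀ t, 0 ≤ t → IsUnit (X t).det)
    (hX : ∀ t, 0 ≤ t → HasDerivWithinAt X (-((B t)ᵀ * X t)) (Set.Ici 0) t)
    (hV : ∀ t, 0 ≤ t → HasDerivWithinAt V (B t * V t + V t * (B t)ᵀ + N t) (Set.Ici 0) t)
    (hN : ∀ t, 0 ≤ t → (N t).PosSemidef) (hVs : ∀ t, 0 ≤ t → (V t)ᵀ = V t)
    (hV0 : (V 0).PosSemidef) {t : ℝ} (ht : 0 ≤ t) : (V t).PosSemidef := by
  refine posSemidef_of_transpose_mul_mul (hXu t ht) (posSemidef_iff.2 ⟨?_, fun x => ?_⟩)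
  · simp [Matrix.transpose_mul, hVs t ht, mul_assoc]
  · have hmono := monotoneOn_of_hasDerivWithinAt_Ici
      (f := fun t => x ⬝ᵥ ((X t)ᵀ * V t * X t) *ᵥ x)
      (f' := fun t => x ⬝ᵥ ((X t)ᵀ * N t * X t) *ᵥ x) (fun t ht => ?_)
      (fun t ht => quad_nonneg (posSemidef_transpose_mul_mul (hN t ht) _) x)
    · have := hmono Set.self_mem_Ici ht ht
      simp only [hX0] at this
      refine le_trans ?_ this
      simpa using quad_nonneg hV0 x
    · refine hasDerivWithinAt_quad ?_ x
      have h1 := ((hasDerivWithinAt_transpose (hX t ht)).mul (hV t ht)).mul (hX t ht)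
      refine h1.congr_deriv ?_
      simp only [Matrix.transpose_neg, Matrix.transpose_mul, Matrix.transpose_transpose,
        Pi.mul_apply]
      noncomm_ring

/-! ### The Riccati flow through its Hamiltonian system -/

lemma exists_linear_flow {E : Type*} [NormedAddCommGroup E] [NormedSpace ℝ E] [CompleteSpace E]
    (L : E →L[ℝ] E) (x : E) : ∃ f : ℝ → E, f 0 = x ∧ ∀ t, HasDerivAt f (L (f t)) t := by
  refine ⟨fun t => NormedSpace.exp (t • L) x, by simp, fun t => ?_⟩
  have h := hasDerivAt_exp_smul_const' (𝕂 := ℝ) L t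
  exact (ContinuousLinearMap.apply ℝ E x).hasFDerivAt.comp_hasDerivAt t h

/-- The generator of the Hamiltonian system of the Riccati equation,
`(X, Y) ↦ (-Aᵀ X + S Y, R X + A Y)`. -/
noncomputable def hamiltonian (A R S : SqMat r) : SqMat r × SqMat r →L[ℝ] SqMat r × SqMat r :=
  LinearMap.toContinuousLinearMap
    { toFun := fun p => (-(Aᵀ * p.1) + S * p.2, R * p.1 + A * p.2)
      map_add' := fun p q => by
        ext1 <;> simp only [Prod.fst_add, Prod.snd_add] <;> noncomm_ring
      map_smul' := fun c p => by
        ext1 <;> simp }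

lemma exists_hamiltonian_flow (A R S Q : SqMat r) : ∃ X Y : ℝ → SqMat r, X 0 = 1 ∧ Y 0 = Q ∧
    (∀ t, HasDerivAt X (-(Aᵀ * X t) + S * Y t) t) ∧
    ∀ t, HasDerivAt Y (R * X t + A * Y t) t := by
  obtain ⟨f, h0, hf⟩ := exists_linear_flow (hamiltonian A R S) (1, Q)
  refine ⟨fun t => (f t).1, fun t => (f t).2, by simp [h0], by simp [h0],
    fun t => ?_, fun t => ?_⟩
  · exact (ContinuousLinearMap.fst ℝ (SqMat r) (SqMat r)).hasFDerivAt.comp_hasDerivAt t (hf t)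
  · exact (ContinuousLinearMap.snd ℝ (SqMat r) (SqMat r)).hasFDerivAt.comp_hasDerivAt t (hf t)

/-- Global solvability of the Riccati equation. In the Hamiltonian system
`∂ₜX = -Aᵀ X + S Y`, `∂ₜY = R X + A Y` the symmetric matrix `Xᵀ Y` is non-decreasing, strictly so
where `X ≠ 0`; hence `X` stays invertible and `Y X⁻¹` is a positive semidefinite solution. The
matrix `X` solves the equation adjoint to that of the transition matrices. -/
lemma exists_riccati_solution (A : SqMat r) {R S Q : SqMat r} (hR : R.PosDef) (hS : S.PosSemidef)
    (hQ : Q.PosSemidef) : ∃ Φ X : ℝ → SqMat r, IsForwardSolution (fun _ => ricc A R S) Q Φ ∧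
      (∀ t, 0 ≤ t → (Φ t).PosSemidef) ∧ X 0 = 1 ∧ (∀ t, 0 ≤ t → IsUnit (X t).det) ∧
      ∀ t, 0 ≤ t → HasDerivWithinAt X (-((A - Φ t * S)ᵀ * X t)) (Set.Ici 0) t := by
  obtain ⟨X, Y, hX0, hY0, hX, hY⟩ := exists_hamiltonian_flow A R S Q
  have hSt := transpose_eq_of_posSemidef hS
  have hQt := transpose_eq_of_posSemidef hQ
  have hRt := transpose_eq_of_posSemidef hR.posSemidef
  have hd : ∀ t, HasDerivAt (fun t => (X t)ᵀ * Y t)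
      ((Y t)ᵀ * S * Y t + (X t)ᵀ * R * X t) t := fun t => by
    have h1 := (hasDerivWithinAt_transpose (hX t).hasDerivWithinAt (s := Set.univ)).mul
      (hY t).hasDerivWithinAt
    rw [hasDerivWithinAt_univ] at h1
    refine h1.congr_deriv ?_
    simp only [Matrix.transpose_add, Matrix.transpose_neg, Matrix.transpose_mul,
      Matrix.transpose_transpose, hSt]
    noncomm_ring
  have hsymm : ∀ t, (Y t)ᵀ * X t = (X t)ᵀ * Y t := fun t => by
    have h2 : ∀ t, HasDerivAt (fun t => (Y t)ᵀ * X t - (X t)ᵀ * Y t) 0 t := fun t => by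
      have h1 := hasDerivWithinAt_transpose (hd t).hasDerivWithinAt (s := Set.univ)
      rw [hasDerivWithinAt_univ] at h1
      have h2 := h1.sub (hd t)
      simp only [Matrix.transpose_mul, Matrix.transpose_transpose, Matrix.transpose_add, hSt,
        hRt] at h2
      refine h2.congr_deriv ?_
      noncomm_ring
    have h3 := is_const_of_deriv_eq_zero (fun t => (h2 t).differentiableAt)
      (fun t => (h2 t).deriv) t 0
    simp only [hX0, hY0, hQt] at h3
    simpa [sub_eq_zero] using h3
  have hN : ∀ t, ((Y t)ᵀ * S * Y t + (X t)ᵀ * R * X t).PosSemidef := fun t =>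
    (posSemidef_transpose_mul_mul hS _).add (posSemidef_transpose_mul_mul hR.posSemidef _)
  have hmono : ∀ x : Fin r → ℝ,
      MonotoneOn (fun t => x ⬝ᵥ ((X t)ᵀ * Y t) *ᵥ x) (Set.Ici 0) := fun x =>
    monotoneOn_of_hasDerivWithinAt_Ici
      (fun t _ => hasDerivWithinAt_quad (hd t).hasDerivWithinAt x)
      (fun t _ => quad_nonneg (hN t) x)
  have hpsd : ∀ t, 0 ≤ t → ((X t)ᵀ * Y t).PosSemidef := fun t ht =>
    posSemidef_iff.2 ⟨by simp [Matrix.transpose_mul, hsymm], fun x => by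
      refine le_trans ?_ (hmono x Set.self_mem_Ici ht ht)
      simpa [hX0, hY0] using quad_nonneg hQ x⟩
  have hunit : ∀ t, 0 ≤ t → IsUnit (X t).det := fun t ht => by
    rw [isUnit_iff_ne_zero]
    intro hdet
    obtain ⟨x, hx, hXx⟩ := Matrix.exists_mulVec_eq_zero_iff.2 hdet
    have ht0 : t ≠ 0 := by
      rintro rfl
      rw [hX0, Matrix.one_mulVec] at hXx
      exact hx hXx
    have htpos : 0 < t := lt_of_le_of_ne ht ht0.symm
    have hend : x ⬝ᵥ ((X t)ᵀ * Y t) *ᵥ x = 0 := by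
      rw [← hsymm, ← Matrix.mulVec_mulVec, hXx]; simp
    -- the form vanishes on `[0, t]`, so its right derivative at `0`, `xᵀ (Q S Q + R) x`, is `0`
    have hz : ∀ s ∈ Set.Icc 0 t, x ⬝ᵥ ((X s)ᵀ * Y s) *ᵥ x = 0 := fun s hs =>
      le_antisymm (hend ▸ hmono x hs.1 ht hs.2) (quad_nonneg (hpsd s hs.1) x)
    have h1 := hasDerivWithinAt_quad (hd 0).hasDerivWithinAt x (s := Set.Icc 0 t)
    have h2 : HasDerivWithinAt (fun s => x ⬝ᵥ ((X s)ᵀ * Y s) *ᵥ x) 0 (Set.Icc 0 t) 0 :=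
      (hasDerivWithinAt_const (0 : ℝ) (Set.Icc 0 t) (0 : ℝ)).congr hz (hz 0 ⟨le_rfl, ht⟩)
    have h3 := (uniqueDiffOn_Icc htpos 0 ⟨le_rfl, ht⟩).eq_deriv _ h1 h2
    rw [Matrix.add_mulVec, dotProduct_add, hX0] at h3
    have h4 := quad_pos hR hx
    have h5 := quad_nonneg (posSemidef_transpose_mul_mul hS (Y 0)) x
    simp at h3
    linarith
  have hΦt : ∀ t, 0 ≤ t → (Y t * (X t)⁻¹).PosSemidef := fun t ht => by
    refine posSemidef_of_transpose_mul_mul (hunit t ht) ?_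
    have : (X t)ᵀ * (Y t * (X t)⁻¹) * X t = (X t)ᵀ * Y t := by
      rw [mul_assoc, mul_assoc (Y t), Matrix.nonsing_inv_mul _ (hunit t ht), mul_one]
    rw [this]; exact hpsd t ht
  refine ⟨fun t => Y t * (X t)⁻¹, X, ⟨by simp [hX0, hY0], fun t ht => ?_⟩, hΦt, hX0, hunit,
    fun t ht => ?_⟩
  · have h1 := (hY t).hasDerivWithinAt.mul
      (hasDerivWithinAt_inv (hX t).hasDerivWithinAt (s := Set.Ici 0) (hunit t ht))
    refine h1.congr_deriv ?_
    have e : X t * (X t)⁻¹ = 1 := Matrix.mul_nonsing_inv _ (hunit t ht)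
    calc _ = R * (X t * (X t)⁻¹) + A * (Y t * (X t)⁻¹)
          + Y t * (X t)⁻¹ * Aᵀ * (X t * (X t)⁻¹) - Y t * (X t)⁻¹ * S * (Y t * (X t)⁻¹) := by
          noncomm_ring
      _ = _ := by simp only [e, ricc]; noncomm_ring
  · refine (hX t).hasDerivWithinAt.congr_deriv ?_
    have e : (X t)⁻¹ * X t = 1 := Matrix.nonsing_inv_mul _ (hunit t ht)
    rw [Matrix.transpose_sub, Matrix.transpose_mul, hSt, transpose_eq_of_posSemidef (hΦt t ht)]
    calc _ = -(Aᵀ * X t) + S * Y t * 1 := by noncomm_ring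
      _ = _ := by rw [← e]; noncomm_ring

lemma ricc_sub_ricc (A R S Q₁ Q₂ : SqMat r) :
    ricc A R S Q₂ - ricc A R S Q₁ =
      (A - Q₂ * S) * (Q₂ - Q₁) + (Q₂ - Q₁) * (Aᵀ - S * Q₁) := by
  simp only [ricc]; noncomm_ring

lemma norm_mul_add_mul_le (B D Z : SqMat r) : ‖B * Z + Z * D‖ ≤ (‖B‖ + ‖D‖) * ‖Z‖ := by
  refine (norm_add_le _ _).trans ?_
  rw [add_mul, mul_comm ‖D‖]
  exact add_le_add (norm_mul_le _ _) (norm_mul_le _ _)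

lemma isWellPosed_ricc (A : SqMat r) {R S Q : SqMat r} (hR : R.PosDef) (hS : S.PosSemidef)
    (hQ : Q.PosSemidef) : IsWellPosed (fun _ => ricc A R S) Q := by
  obtain ⟨Φ, X, hΦ, -⟩ := exists_riccati_solution A hR hS hQ
  refine isWellPosed_of_exists_unique ⟨Φ, hΦ⟩ fun X Y hX hY t ht => ?_
  refine forwardSolution_unique hX hY (k := fun t => ‖A - X t * S‖ + ‖Aᵀ - S * Y t‖) ?_
    (fun t _ => ?_) ht
  · have h1 := IsForwardSolution.continuousOn hX
    have h2 := IsForwardSolution.continuousOn hY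
    fun_prop
  · rw [ricc_sub_ricc]
    exact norm_mul_add_mul_le _ _ _

section Flow

variable {A R S : SqMat r} (hR : R.PosDef) (hS : S.PosSemidef) {Q : SqMat r}
  (hQ : Q.PosSemidef)
include hR hS hQ

lemma riccFlow_zero : riccFlow A R S 0 Q = Q := (isWellPosed_ricc A hR hS hQ).1.1

lemma riccFlow_hasDeriv {t : ℝ} (ht : 0 ≤ t) :
    HasDerivWithinAt (fun t => riccFlow A R S t Q) (ricc A R S (riccFlow A R S t Q))
      (Set.Ici 0) t :=
  (isWellPosed_ricc A hR hS hQ).1.2 t ht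

lemma riccFlow_unique {Y : ℝ → SqMat r} (hY : IsForwardSolution (fun _ => ricc A R S) Q Y) {t : ℝ}
    (ht : 0 ≤ t) : riccFlow A R S t Q = Y t :=
  ((isWellPosed_ricc A hR hS hQ).2 Y hY t ht).symm

lemma riccFlow_continuousOn : ContinuousOn (fun t => riccFlow A R S t Q) (Set.Ici 0) :=
  fun _ ht => (riccFlow_hasDeriv hR hS hQ ht).continuousWithinAt

lemma riccFlow_posSemidef {t : ℝ} (ht : 0 ≤ t) : (riccFlow A R S t Q).PosSemidef := by
  obtain ⟨Φ, X, hΦ, hpsd, -⟩ := exists_riccati_solution A hR hS hQ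
  rw [riccFlow_unique hR hS hQ hΦ ht]
  exact hpsd t ht

lemma riccFlow_transpose {t : ℝ} (ht : 0 ≤ t) : (riccFlow A R S t Q)ᵀ = riccFlow A R S t Q :=
  transpose_eq_of_posSemidef (riccFlow_posSemidef hR hS hQ ht)

/-- The adjoint fundamental matrices, the inverse transposes of the transition matrices. -/
lemma exists_adjoint : ∃ X : ℝ → SqMat r, X 0 = 1 ∧ (∀ t, 0 ≤ t → IsUnit (X t).det) ∧
      ∀ t, 0 ≤ t → HasDerivWithinAt X (-((A - riccFlow A R S t Q * S)ᵀ * X t)) (Set.Ici 0) t := by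
  obtain ⟨Φ, X, hΦ, -, h0, h1, h2⟩ := exists_riccati_solution A hR hS hQ
  refine ⟨X, h0, h1, fun t ht => ?_⟩
  rw [riccFlow_unique hR hS hQ hΦ ht]
  exact h2 t ht

lemma isWellPosed_trans : IsWellPosed (transDrift A R S Q) 1 := by
  obtain ⟨X, h0, h1, h2⟩ := exists_adjoint (A := A) hR hS hQ
  refine isWellPosed_of_exists_unique
    ⟨fun t => ((X t)⁻¹)ᵀ, by simp [h0], fun t ht => ?_⟩ fun Y Z hY hZ t ht => ?_
  · refine (hasDerivWithinAt_transpose (hasDerivWithinAt_inv (h2 t ht) (h1 t ht))).congr_deriv ?_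
    have e : (X t) * (X t)⁻¹ = 1 := Matrix.mul_nonsing_inv _ (h1 t ht)
    rw [transDrift, mul_neg, neg_mul, neg_neg, mul_assoc, mul_assoc, e, mul_one,
      Matrix.transpose_mul, Matrix.transpose_transpose]
  · refine forwardSolution_unique hY hZ (k := fun t => ‖A - riccFlow A R S t Q * S‖) ?_
      (fun t _ => ?_) ht
    · have := riccFlow_continuousOn (A := A) hR hS hQ
      fun_prop
    · rw [transDrift, transDrift, ← mul_sub]
      exact norm_mul_le _ _

lemma transMat_zero : transMat A R S 0 Q = 1 := (isWellPosed_trans hR hS hQ).1.1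

lemma transMat_hasDeriv {t : ℝ} (ht : 0 ≤ t) :
    HasDerivWithinAt (fun t => transMat A R S t Q)
      ((A - riccFlow A R S t Q * S) * transMat A R S t Q) (Set.Ici 0) t :=
  (isWellPosed_trans hR hS hQ).1.2 t ht

end Flow

/-- A Lyapunov type linear equation with continuous coefficients has at most one solution. -/
lemma eq_zero_of_lyapunov {B D V : ℝ → SqMat r} (hB : ContinuousOn B (Set.Ici 0))
    (hD : ContinuousOn D (Set.Ici 0))
    (hV : ∀ t, 0 ≤ t → HasDerivWithinAt V (B t * V t + V t * D t) (Set.Ici 0) t)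
    (h0 : V 0 = 0) {t : ℝ} (ht : 0 ≤ t) : V t = 0 :=
  eq_zero_of_norm_deriv_le (k := fun t => ‖B t‖ + ‖D t‖) (by fun_prop) hV
    (fun _ _ => norm_mul_add_mul_le _ _ _) h0 ht

/-- The difference of two Riccati trajectories factors through the two transition matrices. -/
lemma riccFlow_sub {A R S Q₁ Q₂ : SqMat r} (hR : R.PosDef) (hS : S.PosSemidef)
    (h₁ : Q₁.PosSemidef) (h₂ : Q₂.PosSemidef) {t : ℝ} (ht : 0 ≤ t) :
    riccFlow A R S t Q₂ - riccFlow A R S t Q₁ =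
      transMat A R S t Q₂ * (Q₂ - Q₁) * (transMat A R S t Q₁)ᵀ := by
  rw [← sub_eq_zero]
  have c₁ := riccFlow_continuousOn (A := A) hR hS h₁
  have c₂ := riccFlow_continuousOn (A := A) hR hS h₂
  refine eq_zero_of_lyapunov (B := fun t => A - riccFlow A R S t Q₂ * S)
    (D := fun t => Aᵀ - S * riccFlow A R S t Q₁)
    (V := fun t => riccFlow A R S t Q₂ - riccFlow A R S t Q₁ -
      transMat A R S t Q₂ * (Q₂ - Q₁) * (transMat A R S t Q₁)ᵀ)
    (by fun_prop) (by fun_prop) (fun t ht => ?_) ?_ ht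
  · have e₁ := transMat_hasDeriv (A := A) hR hS h₁ ht
    have e₂ := transMat_hasDeriv (A := A) hR hS h₂ ht
    refine (((riccFlow_hasDeriv hR hS h₂ ht).fun_sub (riccFlow_hasDeriv hR hS h₁ ht)).fun_sub
      ((e₂.mul_const (Q₂ - Q₁)).fun_mul (hasDerivWithinAt_transpose e₁))).congr_deriv ?_
    rw [ricc_sub_ricc, Matrix.transpose_mul, Matrix.transpose_sub, Matrix.transpose_mul,
      transpose_eq_of_posSemidef hS, riccFlow_transpose hR hS h₁ ht]
    noncomm_ring
  · simp [riccFlow_zero hR hS h₁, riccFlow_zero hR hS h₂, transMat_zero hR hS h₁,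
      transMat_zero hR hS h₂]

lemma riccFlow_mono {A R S Q₁ Q₂ : SqMat r} (hR : R.PosDef) (hS : S.PosSemidef)
    (h₁ : Q₁.PosSemidef) (h₂ : Q₂.PosSemidef) (h : (Q₂ - Q₁).PosSemidef) {t : ℝ} (ht : 0 ≤ t) :
    (riccFlow A R S t Q₂ - riccFlow A R S t Q₁).PosSemidef := by
  obtain ⟨X, x0, xu, hX⟩ := exists_adjoint (A := A) hR hS h₂
  refine posSemidef_of_lyapunov x0 xu hX
    (V := fun t => riccFlow A R S t Q₂ - riccFlow A R S t Q₁)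
    (N := fun t => (riccFlow A R S t Q₂ - riccFlow A R S t Q₁) * S *
      (riccFlow A R S t Q₂ - riccFlow A R S t Q₁)) (fun t ht => ?_) (fun t ht => ?_)
    (fun t ht => ?_) ?_ ht
  · refine ((riccFlow_hasDeriv hR hS h₂ ht).fun_sub
      (riccFlow_hasDeriv hR hS h₁ ht)).congr_deriv ?_
    rw [ricc_sub_ricc, Matrix.transpose_sub, Matrix.transpose_mul,
      transpose_eq_of_posSemidef hS, riccFlow_transpose hR hS h₂ ht]
    noncomm_ring
  · refine posSemidef_mul_mul_self hS ?_
    rw [Matrix.transpose_sub, riccFlow_transpose hR hS h₁ ht, riccFlow_transpose hR hS h₂ ht]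
  · rw [Matrix.transpose_sub, riccFlow_transpose hR hS h₁ ht, riccFlow_transpose hR hS h₂ ht]
  · simpa [riccFlow_zero hR hS h₁, riccFlow_zero hR hS h₂] using h

lemma riccFlow_eq_self {A R S P : SqMat r} (hR : R.PosDef) (hS : S.PosSemidef)
    (hP : P.PosSemidef) (h : ricc A R S P = 0) {t : ℝ} (ht : 0 ≤ t) : riccFlow A R S t P = P :=
  riccFlow_unique (Y := fun _ => P) hR hS hP
    ⟨rfl, fun t _ => by simpa [h] using hasDerivWithinAt_const t (Set.Ici 0) P⟩ ht

/-- The adjoint fundamental matrices of `A - K S` for a supersolution `K` of the algebraic Riccati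
equation: `K` is an exact solution for the larger noise matrix `R - Ricc(K)`. -/
lemma exists_adjoint_of_supersolution {A R S K : SqMat r} (hR : R.PosDef) (hS : S.PosSemidef)
    (hK : K.PosSemidef) (h : (-ricc A R S K).PosSemidef) :
    ∃ X : ℝ → SqMat r, X 0 = 1 ∧ (∀ t, 0 ≤ t → IsUnit (X t).det) ∧
      ∀ t, 0 ≤ t → HasDerivWithinAt X (-((A - K * S)ᵀ * X t)) (Set.Ici 0) t := by
  have hR' : (R - ricc A R S K).PosDef := by
    rw [sub_eq_add_neg]; exact hR.add_posSemidef h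
  have h0 : ricc A (R - ricc A R S K) S K = 0 := by simp only [ricc]; noncomm_ring
  obtain ⟨X, h1, h2, h3⟩ := exists_adjoint (A := A) hR' hS hK
  refine ⟨X, h1, h2, fun t ht => ?_⟩
  have := h3 t ht
  rwa [riccFlow_eq_self hR' hS hK h0 ht] at this

/-- Trajectories started below a supersolution `K` of the algebraic equation stay below `K`. -/
lemma riccFlow_le_of_supersolution {A R S K Q : SqMat r} (hR : R.PosDef) (hS : S.PosSemidef)
    (hK : K.PosSemidef) (h : (-ricc A R S K).PosSemidef) (hQ : Q.PosSemidef)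
    (hQK : (K - Q).PosSemidef) {t : ℝ} (ht : 0 ≤ t) : (K - riccFlow A R S t Q).PosSemidef := by
  obtain ⟨X, x0, xu, hX⟩ := exists_adjoint_of_supersolution hR hS hK h
  have hsym : ∀ t, 0 ≤ t → (K - riccFlow A R S t Q)ᵀ = K - riccFlow A R S t Q := fun t ht => by
    rw [Matrix.transpose_sub, riccFlow_transpose hR hS hQ ht, transpose_eq_of_posSemidef hK]
  refine posSemidef_of_lyapunov (B := fun _ => A - K * S) x0 xu hX
    (V := fun t => K - riccFlow A R S t Q)
    (N := fun t => (K - riccFlow A R S t Q) * S * (K - riccFlow A R S t Q) + -ricc A R S K)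
    (fun t ht => ?_) (fun t ht => ?_) hsym ?_ ht
  · refine ((riccFlow_hasDeriv hR hS hQ ht).const_sub K).congr_deriv ?_
    rw [Matrix.transpose_sub, Matrix.transpose_mul, transpose_eq_of_posSemidef hS,
      transpose_eq_of_posSemidef hK]
    simp only [ricc]
    noncomm_ring
  · exact (posSemidef_mul_mul_self hS (hsym t ht)).add h
  · simpa [riccFlow_zero hR hS hQ] using hQK

/-! ### Observability and the stationary matrix -/

lemma mulVec_eq_zero_of_observable {m : ℕ} {A : SqMat r} {C : Matrix (Fin m) (Fin r) ℝ}
    (hobs : (observabilityMatrix A C).rank = r) {x : Fin r → ℝ}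
    (h : ∀ k : ℕ, (C * A ^ k) *ᵥ x = 0) : x = 0 := by
  have hinj : Function.Injective (observabilityMatrix A C).mulVecLin := by
    rw [← LinearMap.ker_eq_bot, ← Submodule.finrank_eq_zero]
    have h1 := (observabilityMatrix A C).mulVecLin.finrank_range_add_finrank_ker
    rw [← Matrix.rank, hobs, Module.finrank_fin_fun] at h1
    omega
  apply hinj
  rw [map_zero]
  ext p
  have := congrFun (h p.1) p.2
  simpa [observabilityMatrix, Matrix.mulVec, dotProduct] using this

/-- The Gramian of an observable pair, weighted so as to solve a Lyapunov inequality: with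
`Z t = exp (-t (A + 1))`, it is `∫₀¹ Zᵀ S Z`. -/
lemma exists_gramian {m : ℕ} {A : SqMat r} {C : Matrix (Fin m) (Fin r) ℝ}
    (hobs : (observabilityMatrix A C).rank = r) {S : SqMat r} (hS : S.PosSemidef)
    (hSC : ∀ x, x ⬝ᵥ S *ᵥ x = 0 → C *ᵥ x = 0) :
    ∃ W M : SqMat r, W.PosDef ∧ M.PosSemidef ∧ Aᵀ * W + W * A + (2 : ℝ) • W = S - M := by
  obtain ⟨Z, hZ0, hZl, hZr⟩ : ∃ Z : ℝ → SqMat r, Z 0 = 1 ∧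
      (∀ t, HasDerivAt Z (-((A + 1) * Z t)) t) ∧ ∀ t, HasDerivAt Z (-(Z t * (A + 1))) t := by
    refine ⟨fun t => NormedSpace.exp (t • (-(A + 1))), by simp, fun t => ?_, fun t => ?_⟩
    · simpa only [neg_mul] using hasDerivAt_exp_smul_const' (𝕂 := ℝ) (-(A + 1)) t
    · simpa only [mul_neg] using hasDerivAt_exp_smul_const (𝕂 := ℝ) (-(A + 1)) t
  set N : ℝ → SqMat r := fun t => (Z t)ᵀ * S * Z t with hN
  have hNpsd : ∀ t, (N t).PosSemidef := fun t => posSemidef_transpose_mul_mul hS _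
  have hd : ∀ t, HasDerivAt N (-((A + 1)ᵀ * N t + N t * (A + 1))) t := fun t => by
    have h1 := (((hasDerivWithinAt_transpose ((hZr t).hasDerivWithinAt (s := Set.univ))).mul_const
      S).mul (hZr t).hasDerivWithinAt)
    rw [hasDerivWithinAt_univ] at h1
    refine h1.congr_deriv ?_
    simp only [Matrix.transpose_neg, Matrix.transpose_mul, hN]
    noncomm_ring
  have hNc : Continuous N := continuous_iff_continuousAt.2 fun t => (hd t).continuousAt
  set W : SqMat r := ∫ t in (0 : ℝ)..1, N t with hW
  have hlin : ∀ {F : Type} [NormedAddCommGroup F] [NormedSpace ℝ F] [CompleteSpace F]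
      (L : SqMat r →ₗ[ℝ] F), L W = ∫ t in (0 : ℝ)..1, L (N t) := fun L =>
    ((LinearMap.toContinuousLinearMap L).intervalIntegral_comp_comm
      (hNc.intervalIntegrable 0 1)).symm
  have hWt : Wᵀ = W := by
    have := hlin (Matrix.transposeLinearEquiv (Fin r) (Fin r) ℝ ℝ).toLinearMap
    refine this.trans (intervalIntegral.integral_congr fun t _ => ?_)
    exact transpose_eq_of_posSemidef (hNpsd t)
  have hWx : ∀ x, x ⬝ᵥ W *ᵥ x = ∫ t in (0 : ℝ)..1, x ⬝ᵥ N t *ᵥ x := fun x => hlin (quadLin x)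
  have hWpos : W.PosDef := by
    refine Matrix.PosDef.of_dotProduct_mulVec_pos (by
      rw [Matrix.IsHermitian, Matrix.conjTranspose_eq_transpose_of_trivial, hWt]) fun x hx => ?_
    rw [star_trivial, hWx]
    have hc : Continuous fun t => x ⬝ᵥ N t *ᵥ x :=
      (LinearMap.continuous_of_finiteDimensional (quadLin x)).comp hNc
    refine intervalIntegral.integral_pos one_pos hc.continuousOn
      (fun t _ => quad_nonneg (hNpsd t) x) ?_
    by_contra! hneg
    apply hx
    -- `C Aᵏ Z x` vanishes on `[0, 1]` for every `k`, by differentiating repeatedly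
    have hz : ∀ k : ℕ, ∀ t ∈ Set.Icc (0 : ℝ) 1, (C * A ^ k) *ᵥ (Z t *ᵥ x) = 0 := by
      intro k
      induction k with
      | zero =>
        intro t ht
        rw [pow_zero, Matrix.mul_one]
        refine hSC _ ?_
        rw [← quad_conj]
        exact le_antisymm (hneg t ht) (quad_nonneg (hNpsd t) x)
      | succ k ih =>
        intro t ht
        let L : SqMat r →ₗ[ℝ] (Fin m → ℝ) :=
          { toFun := fun M => (C * A ^ k) *ᵥ (M *ᵥ x)
            map_add' := fun M N => by rw [Matrix.add_mulVec, Matrix.mulVec_add]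
            map_smul' := fun c M => by
              rw [Matrix.smul_mulVec, Matrix.mulVec_smul, RingHom.id_apply] }
        have h1 := hasDerivWithinAt_linear L (hZl t).hasDerivWithinAt (s := Set.Icc 0 1)
        have h2 : HasDerivWithinAt (fun u => L (Z u)) 0 (Set.Icc 0 1) t :=
          (hasDerivWithinAt_const t (Set.Icc (0 : ℝ) 1) (0 : Fin m → ℝ)).congr ih (ih t ht)
        have h3 := (uniqueDiffOn_Icc one_pos t ht).eq_deriv _ h1 h2
        have h4 : L (-((A + 1) * Z t)) =
            -((C * A ^ (k + 1)) *ᵥ (Z t *ᵥ x) + (C * A ^ k) *ᵥ (Z t *ᵥ x)) := by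
          simp only [L, LinearMap.coe_mk, AddHom.coe_mk, Matrix.mulVec_mulVec,
            ← Matrix.add_mulVec, ← Matrix.neg_mulVec]
          congr 1
          rw [pow_succ, ← Matrix.mul_assoc C, Matrix.mul_assoc (C * A ^ k) A, ← Matrix.mul_add,
            Matrix.mul_neg, add_mul, one_mul]
        rw [h4, ih t ht, add_zero, neg_eq_zero] at h3
        exact h3
    refine mulVec_eq_zero_of_observable hobs fun k => ?_
    simpa [hZ0] using hz k 0 ⟨le_rfl, zero_le_one⟩
  refine ⟨W, N 1, hWpos, hNpsd 1, ?_⟩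
  have h1 := intervalIntegral.integral_eq_sub_of_hasDerivAt (a := 0) (b := 1)
    (fun t _ => hd t) (Continuous.intervalIntegrable (by fun_prop) 0 1)
  have h2 : ∫ t in (0 : ℝ)..1, -((A + 1)ᵀ * N t + N t * (A + 1)) =
      -((A + 1)ᵀ * W + W * (A + 1)) :=
    (hlin (-(LinearMap.mulLeft ℝ (A + 1)ᵀ + LinearMap.mulRight ℝ (A + 1)))).symm
  rw [h2] at h1
  have h3 : N 0 = S := by simp [hN, hZ0]
  rw [h3] at h1
  rw [← neg_sub (N 1), ← h1, two_smul, Matrix.transpose_add, Matrix.transpose_one]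
  noncomm_ring

/-- An observable pair admits a positive definite `K` with `Ricc(K) ≤ 0`: a large multiple of the
inverse of the weighted Gramian. -/
lemma exists_supersolution {m : ℕ} {A R : SqMat r} {C : Matrix (Fin m) (Fin r) ℝ}
    (hobs : (observabilityMatrix A C).rank = r) {S : SqMat r} (hS : S.PosSemidef)
    (hSC : ∀ x, x ⬝ᵥ S *ᵥ x = 0 → C *ᵥ x = 0) (hR : R.PosDef) :
    ∃ K : SqMat r, K.PosSemidef ∧ (-ricc A R S K).PosSemidef := by
  obtain ⟨W, M, hW, hM, hWM⟩ := exists_gramian hobs hS hSC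
  have hu : IsUnit W.det := (Matrix.isUnit_iff_isUnit_det W).1 hW.isUnit
  have hK : (W⁻¹).PosDef := hW.inv
  have hKt := transpose_eq_of_posSemidef hK.posSemidef
  have e1 : W⁻¹ * W = 1 := Matrix.nonsing_inv_mul W hu
  have e2 : W * W⁻¹ = 1 := Matrix.mul_nonsing_inv W hu
  obtain ⟨k, hk0, hk⟩ := exists_pos_dotProduct_le_quad hK
  set K := W⁻¹ with hKdef
  set c := 1 + ‖R‖ * k with hc
  have hc1 : 1 ≤ c := by rw [hc]; nlinarith [norm_nonneg R]
  have hRK : ((2 * c) • K - R).PosSemidef := by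
    refine posSemidef_iff.2 ⟨by simp [hKt, transpose_eq_of_posSemidef hR.posSemidef],
      fun x => ?_⟩
    rw [Matrix.sub_mulVec, dotProduct_sub, Matrix.smul_mulVec, dotProduct_smul, smul_eq_mul]
    have h1 := quad_le R x
    have h2 := mul_le_mul_of_nonneg_left (hk x) (norm_nonneg R)
    have h3 := quad_nonneg hK.posSemidef x
    rw [hc]
    nlinarith [mul_nonneg (mul_nonneg (norm_nonneg R) hk0.le) h3]
  refine ⟨c • K, hK.posSemidef.smul (by positivity), ?_⟩
  have e3 : K * Aᵀ + A * K + (2 : ℝ) • K = K * S * K - K * M * K := by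
    have : K * (Aᵀ * W + W * A + (2 : ℝ) • W) * K = K * (S - M) * K := by rw [hWM]
    calc K * Aᵀ + A * K + (2 : ℝ) • K
        = K * Aᵀ * (W * K) + (K * W) * A * K + (2 : ℝ) • ((K * W) * K) := by
          rw [e1, e2]; simp
      _ = K * (Aᵀ * W + W * A + (2 : ℝ) • W) * K := by
          simp only [mul_add, add_mul, mul_smul_comm, smul_mul_assoc, mul_assoc]
      _ = _ := by rw [this]; noncomm_ring
  have e4 : -ricc A R S (c • K) =
      (c ^ 2 - c) • (K * S * K) + c • (K * M * K) + ((2 * c) • K - R) := by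
    have e5 : A * K + K * Aᵀ = K * S * K - K * M * K - (2 : ℝ) • K := by rw [← e3]; abel
    have e6 : ricc A R S (c • K) = c • (A * K + K * Aᵀ) - c ^ 2 • (K * S * K) + R := by
      simp only [ricc, mul_smul_comm, smul_mul_assoc, smul_add, smul_smul, sq]
    rw [e6, e5]
    module
  rw [e4]
  exact (((posSemidef_mul_mul_self hS hKt).smul (by nlinarith)).add
    ((posSemidef_mul_mul_self hM hKt).smul (by positivity))).add hRK

/-- The velocity of a convergent curve can only converge to `0`. -/
lemma eq_zero_of_tendsto_deriv {E : Type*} [NormedAddCommGroup E] [NormedSpace ℝ E]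
    {f f' : ℝ → E} {l L : E} (h : ∀ t, 0 ≤ t → HasDerivWithinAt f (f' t) (Set.Ici 0) t)
    (hf : Filter.Tendsto f Filter.atTop (nhds l))
    (hf' : Filter.Tendsto f' Filter.atTop (nhds L)) : L = 0 := by
  rw [← norm_le_zero_iff]
  refine le_of_forall_pos_le_add fun ε hε => ?_
  rw [zero_add]
  have h1 : Filter.Tendsto (fun t => ‖f (t + 1) - f t - L‖) Filter.atTop (nhds ‖l - l - L‖) :=
    (((hf.comp (Filter.tendsto_atTop_add_const_right _ 1 Filter.tendsto_id)).sub hf).sub_const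
      L).norm
  rw [sub_self, zero_sub, norm_neg] at h1
  refine le_of_tendsto h1 ?_
  obtain ⟨T, hT⟩ := Filter.eventually_atTop.1 ((Metric.tendsto_nhds.1 hf') ε hε)
  filter_upwards [Filter.eventually_ge_atTop (max T 0)] with t ht
  have hT' : T ≤ t := (le_max_left _ _).trans ht
  have h0' : 0 ≤ t := (le_max_right _ _).trans ht
  have h2 := norm_image_sub_le_of_norm_deriv_le_segment' (f := fun u => f u - u • L)
    (f' := fun u => f' u - L) (a := t) (b := t + 1) (C := ε)
    (fun u hu => by
      have h3 := ((hasDerivAt_id u).smul_const L).hasDerivWithinAt (s := Set.Ici 0)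
      rw [one_smul] at h3
      exact ((h u (h0'.trans hu.1)).fun_sub h3).mono
        (fun v hv => h0'.trans hv.1))
    (fun u hu => by rw [← dist_eq_norm]; exact (hT u (hT'.trans hu.1)).le)
    (t + 1) ⟨by linarith, le_rfl⟩
  have h4 : f (t + 1) - (t + 1) • L - (f t - t • L) = f (t + 1) - f t - L := by module
  rw [h4] at h2
  linarith

lemma tendsto_of_tendsto_quad {ι : Type*} {l : Filter ι} {f : ι → SqMat r}
    (hf : ∀ i, (f i)ᵀ = f i)
    (h : ∀ x : Fin r → ℝ, ∃ a, Filter.Tendsto (fun i => x ⬝ᵥ f i *ᵥ x) l (nhds a)) :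
    ∃ P : SqMat r, Filter.Tendsto f l (nhds P) := by
  have hent : ∀ i j, ∃ a, Filter.Tendsto (fun k => f k i j) l (nhds a) := fun i j => by
    obtain ⟨a, ha⟩ := h (Pi.single i 1 + Pi.single j 1)
    obtain ⟨b, hb⟩ := h (Pi.single i 1)
    obtain ⟨c, hc⟩ := h (Pi.single j 1)
    refine ⟨(a - b - c) / 2, (((ha.sub hb).sub hc).div_const 2).congr fun k => ?_⟩
    have : f k j i = f k i j := by rw [← hf k, Matrix.transpose_apply, hf k]
    simp [Matrix.mulVec_add, add_dotProduct, dotProduct_add, this]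
    ring
  choose P hP using hent
  exact ⟨Matrix.of P, tendsto_pi_nhds.2 fun i => tendsto_pi_nhds.2 fun j => hP i j⟩

lemma posSemidef_of_tendsto {ι : Type*} {l : Filter ι} [l.NeBot] {f : ι → SqMat r} {P : SqMat r}
    (hf : ∀ᶠ i in l, (f i).PosSemidef) (h : Filter.Tendsto f l (nhds P)) : P.PosSemidef := by
  refine posSemidef_iff.2 ⟨?_, fun x => ?_⟩
  · have h1 : Filter.Tendsto (fun i => (f i)ᵀ) l (nhds Pᵀ) :=
      ((LinearMap.continuous_of_finiteDimensional
        (Matrix.transposeLinearEquiv (Fin r) (Fin r) ℝ ℝ).toLinearMap).tendsto P).comp h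
    refine tendsto_nhds_unique h1 (h.congr' ?_)
    filter_upwards [hf] with i hi using (transpose_eq_of_posSemidef hi).symm
  · refine ge_of_tendsto (((LinearMap.continuous_of_finiteDimensional
      (quadLin x)).tendsto P).comp h) ?_
    filter_upwards [hf] with i hi using quad_nonneg hi x

/-- A positive semidefinite stationary matrix is positive definite, as `P x = 0` forces
`xᵀ R x = 0`. -/
lemma posDef_of_ricc_eq_zero {A R S P : SqMat r} (hR : R.PosDef) (hP : P.PosSemidef)
    (h : ricc A R S P = 0) : P.PosDef := by
  have hPt := transpose_eq_of_posSemidef hP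
  refine Matrix.PosDef.of_dotProduct_mulVec_pos hP.1 fun x hx => ?_
  rw [star_trivial]
  refine lt_of_le_of_ne (quad_nonneg hP x) fun h0 => ?_
  have hPx : P *ᵥ x = 0 := by
    have h1 := dotProduct_mulVec_sq_le hP (P *ᵥ x) x
    rw [← h0, mul_zero] at h1
    exact eq_zero_of_dotProduct_self (by nlinarith [sq_nonneg ((P *ᵥ x) ⬝ᵥ P *ᵥ x)])
  have hz : ∀ M : SqMat r, x ⬝ᵥ (P * M) *ᵥ x = 0 := fun M => by
    rw [← Matrix.mulVec_mulVec, dotProduct_mulVec_comm hPt, hPx, dotProduct_zero]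
  have h2 : x ⬝ᵥ ricc A R S P *ᵥ x = x ⬝ᵥ R *ᵥ x := by
    rw [ricc, mul_assoc P S P, Matrix.add_mulVec, Matrix.sub_mulVec, Matrix.add_mulVec]
    simp only [dotProduct_add, dotProduct_sub, hz]
    rw [← Matrix.mulVec_mulVec, hPx]
    simp
  rw [h, Matrix.zero_mulVec, dotProduct_zero] at h2
  exact (quad_pos hR hx).ne h2

/-- The trajectory started at `0` increases to a positive definite solution of the algebraic
Riccati equation. -/
lemma exists_stationary {m : ℕ} {A R : SqMat r} {C : Matrix (Fin m) (Fin r) ℝ}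
    (hobs : (observabilityMatrix A C).rank = r) {S : SqMat r} (hS : S.PosSemidef)
    (hSC : ∀ x, x ⬝ᵥ S *ᵥ x = 0 → C *ᵥ x = 0) (hR : R.PosDef) :
    ∃ P : SqMat r, P.PosDef ∧ ricc A R S P = 0 ∧
      Filter.Tendsto (fun t => riccFlow A R S t 0) Filter.atTop (nhds P) := by
  obtain ⟨K, hK, hKle⟩ := exists_supersolution hobs hS hSC hR
  have z : (0 : SqMat r).PosSemidef := Matrix.PosSemidef.zero
  have hpsd := fun t (ht : 0 ≤ t) => riccFlow_posSemidef (A := A) hR hS z ht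
  have hmono : ∀ s t : ℝ, 0 ≤ s → s ≤ t →
      (riccFlow A R S t 0 - riccFlow A R S s 0).PosSemidef := fun s t hs hst => by
    have h1 : riccFlow A R S t 0 = riccFlow A R S s (riccFlow A R S (t - s) 0) := by
      have := odeFlow_add (F := ricc A R S) (Q := 0) (s := t - s) (t := s) (by linarith) hs
        (isWellPosed_ricc A hR hS z) (isWellPosed_ricc A hR hS (hpsd (t - s) (by linarith)))
      rwa [add_sub_cancel] at this
    rw [h1]
    have h2 := hpsd (t - s) (by linarith)
    exact riccFlow_mono hR hS z h2 (by simpa using h2) hs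
  obtain ⟨P, hP⟩ := tendsto_of_tendsto_quad (l := Filter.atTop)
    (f := fun t : ℝ => riccFlow A R S (max t 0) 0)
    (fun t => riccFlow_transpose hR hS z (le_max_right _ _)) fun x => by
      refine ⟨_, tendsto_atTop_ciSup (fun s t hst => ?_) ⟨x ⬝ᵥ K *ᵥ x, ?_⟩⟩
      · have := quad_nonneg (hmono _ _ (le_max_right s 0) (max_le_max_right 0 hst)) x
        rw [Matrix.sub_mulVec, dotProduct_sub] at this
        linarith
      · rintro _ ⟨t, rfl⟩
        have := quad_nonneg (riccFlow_le_of_supersolution hR hS hK hKle z (by simpa using hK)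
          (le_max_right t 0)) x
        rw [Matrix.sub_mulVec, dotProduct_sub] at this
        simp only
        linarith
  have hP' : Filter.Tendsto (fun t => riccFlow A R S t 0) Filter.atTop (nhds P) := by
    refine hP.congr' ?_
    filter_upwards [Filter.eventually_ge_atTop 0] with t ht
    rw [max_eq_left ht]
  have hPpsd : P.PosSemidef := posSemidef_of_tendsto
    (by filter_upwards [Filter.eventually_ge_atTop 0] with t ht using hpsd t ht) hP'
  have hric : ricc A R S P = 0 := by
    refine eq_zero_of_tendsto_deriv (fun t ht => riccFlow_hasDeriv hR hS z ht) hP' ?_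
    have hc : Continuous (ricc A R S) := by unfold ricc; fun_prop
    exact (hc.tendsto P).comp hP'
  exact ⟨P, posDef_of_ricc_eq_zero hR hPpsd hric, hric, hP'⟩

/-! ### Exponential decay of the transition matrices -/

/-- Upper bound of a trajectory by the stationary matrix: the right-hand side is a supersolution
for the constant gain of `P`. -/
lemma riccFlow_sub_stationary_le {A R S P Q : SqMat r} (hR : R.PosDef) (hS : S.PosSemidef)
    (hP : P.PosDef) (h : ricc A R S P = 0) (hQ : Q.PosSemidef) {c ε : ℝ} (hc : 0 ≤ c)
    (hε : (R - ε • P).PosSemidef) (hcP : (c • P - Q).PosSemidef) {t : ℝ} (ht : 0 ≤ t) :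
    ((c * Real.exp (-ε * t)) • P - (riccFlow A R S t Q - P)).PosSemidef := by
  have hPt := transpose_eq_of_posSemidef hP.posSemidef
  obtain ⟨X, x0, xu, hX⟩ := exists_adjoint_of_supersolution (A := A) hR hS hP.posSemidef
    (by rw [h, neg_zero]; exact Matrix.PosSemidef.zero)
  have hU : ∀ t, 0 ≤ t → (riccFlow A R S t Q - P)ᵀ = riccFlow A R S t Q - P := fun t ht => by
    rw [Matrix.transpose_sub, riccFlow_transpose hR hS hQ ht, hPt]
  refine posSemidef_of_lyapunov (B := fun _ => A - P * S) x0 xu hX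
    (V := fun t => (c * Real.exp (-ε * t)) • P - (riccFlow A R S t Q - P))
    (N := fun t => (c * Real.exp (-ε * t)) • ((R - ε • P) + P * S * P) +
      (riccFlow A R S t Q - P) * S * (riccFlow A R S t Q - P))
    (fun t ht => ?_) (fun t ht => ?_) (fun t ht => ?_) ?_ ht
  · have h1 : HasDerivAt (fun t => c * Real.exp (-ε * t)) (-(c * Real.exp (-ε * t)) * ε) t := by
      have := (((hasDerivAt_id t).const_mul (-ε)).exp).const_mul c
      simp only [id_eq, mul_one] at this
      exact this.congr_deriv (by ring)
    refine ((h1.hasDerivWithinAt.smul_const P).fun_sub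
      ((riccFlow_hasDeriv hR hS hQ ht).sub_const P)).congr_deriv ?_
    generalize c * Real.exp (-ε * t) = a
    generalize riccFlow A R S t Q = Φ
    have e : R = -(A * P) - P * Aᵀ + P * S * P := by
      rw [← sub_eq_zero, ← h, ricc]; abel
    rw [Matrix.transpose_sub, Matrix.transpose_mul, transpose_eq_of_posSemidef hS, hPt, ricc, e]
    simp only [mul_sub, sub_mul, smul_add, smul_sub, smul_neg,
      smul_mul_assoc, mul_smul_comm, mul_assoc]
    module
  · exact ((hε.add (posSemidef_mul_mul_self hS hPt)).smul (by positivity)).add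
      (posSemidef_mul_mul_self hS (hU t ht))
  · rw [Matrix.transpose_sub, Matrix.transpose_smul, hPt, hU t ht]
  · have e0 : (c * Real.exp (-ε * 0)) • P - (riccFlow A R S 0 Q - P) = (c • P - Q) + P := by
      rw [riccFlow_zero hR hS hQ, mul_zero, Real.exp_zero, mul_one]; abel
    rw [e0]
    exact hcP.add hP.posSemidef

/-- A trajectory is squeezed between the one from `0` and the previous upper bound. -/
lemma norm_riccFlow_sub_stationary_le {A R S P Q : SqMat r} (hR : R.PosDef) (hS : S.PosSemidef)
    (hP : P.PosDef) (h : ricc A R S P = 0) (hQ : Q.PosSemidef) {c ε : ℝ} (hc : 0 ≤ c)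
    (hε : (R - ε • P).PosSemidef) (hcP : (c • P - Q).PosSemidef) {t : ℝ} (ht : 0 ≤ t) :
    ‖riccFlow A R S t Q - P‖ ≤
      c * Real.exp (-ε * t) * ‖P‖ + 2 * ‖P - riccFlow A R S t 0‖ := by
  have z : (0 : SqMat r).PosSemidef := Matrix.PosSemidef.zero
  have h1 := riccFlow_mono (A := A) hR hS z hQ (by simpa using hQ) ht
  have h2 := riccFlow_sub_stationary_le hR hS hP h hQ hc hε hcP ht
  have h3 : ‖riccFlow A R S t Q - riccFlow A R S t 0‖ ≤
      ‖(c * Real.exp (-ε * t)) • P + (P - riccFlow A R S t 0)‖ :=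
    norm_le_norm_of_posSemidef_sub h1 (by convert h2 using 1; abel)
  have h4 : ‖(c * Real.exp (-ε * t)) • P‖ = c * Real.exp (-ε * t) * ‖P‖ := by
    rw [norm_smul, Real.norm_of_nonneg (by positivity)]
  have h5 := norm_add_le ((c * Real.exp (-ε * t)) • P) (P - riccFlow A R S t 0)
  have h7 : riccFlow A R S t Q - riccFlow A R S t 0 - (P - riccFlow A R S t 0) =
    riccFlow A R S t Q - P := by abel
  have h8 := norm_sub_le (riccFlow A R S t Q - riccFlow A R S t 0) (P - riccFlow A R S t 0)
  rw [h7] at h8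
  linarith

lemma dotProduct_mulVec_self_le_quad {P : SqMat r} (hP : P.PosSemidef) (z : Fin r → ℝ) :
    (P *ᵥ z) ⬝ᵥ (P *ᵥ z) ≤ ‖P‖ * (z ⬝ᵥ P *ᵥ z) := by
  have h1 := dotProduct_mulVec_sq_le hP (P *ᵥ z) z
  have h2 := mul_le_mul_of_nonneg_right (quad_le P (P *ᵥ z)) (quad_nonneg hP z)
  rcases (dotProduct_self_nonneg' (P *ᵥ z)).eq_or_lt with h0 | h0
  · rw [← h0]; exact mul_nonneg (norm_nonneg _) (quad_nonneg hP z)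
  · refine le_of_mul_le_mul_left ?_ h0
    nlinarith

/-- The form `eᵀ P⁻¹ e` along `e = E_t(Q) x` as a Lyapunov function. Its drift is the
form of `-R - (P + U) S (P + U) + U S U`, with `U = φ_t(Q) - P`, at `P⁻¹ e`. -/
lemma exists_lyapunov_deriv {A R S P Q : SqMat r} (hR : R.PosDef) (hS : S.PosSemidef)
    (hP : P.PosDef) (h : ricc A R S P = 0) (hQ : Q.PosSemidef) {l ε : ℝ}
    (hl : ∀ x, x ⬝ᵥ x ≤ l * (x ⬝ᵥ P *ᵥ x)) (hε : (R - ε • P).PosSemidef) (x : Fin r → ℝ) :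
    ∃ f' : ℝ → ℝ, (∀ t, 0 ≤ t → HasDerivWithinAt
        (fun t => x ⬝ᵥ ((transMat A R S t Q)ᵀ * P⁻¹ * transMat A R S t Q) *ᵥ x) (f' t)
        (Set.Ici 0) t) ∧
      ∀ t, 0 ≤ t → f' t ≤ (-ε + l * ‖S‖ * ‖riccFlow A R S t Q - P‖ ^ 2) *
        (x ⬝ᵥ ((transMat A R S t Q)ᵀ * P⁻¹ * transMat A R S t Q) *ᵥ x) := by
  have hPt := transpose_eq_of_posSemidef hP.posSemidef
  have hu : IsUnit P.det := (Matrix.isUnit_iff_isUnit_det P).1 hP.isUnit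
  have hPi := transpose_eq_of_posSemidef hP.inv.posSemidef
  have e1 : P⁻¹ * P = 1 := Matrix.nonsing_inv_mul P hu
  have e2 : P * P⁻¹ = 1 := Matrix.mul_nonsing_inv P hu
  set Z : ℝ → SqMat r := fun t => P⁻¹ * transMat A R S t Q with hZ
  have hE : ∀ t, transMat A R S t Q = P * Z t := fun t => by rw [hZ, ← mul_assoc, e2, one_mul]
  set U : ℝ → SqMat r := fun t => riccFlow A R S t Q - P with hU
  have hUt : ∀ t, 0 ≤ t → (U t)ᵀ = U t := fun t ht => by
    simp only [hU]; rw [Matrix.transpose_sub, riccFlow_transpose hR hS hQ ht, hPt]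
  refine ⟨fun t => x ⬝ᵥ ((Z t)ᵀ * (-R - (P + U t) * S * (P + U t) + U t * S * U t) * Z t) *ᵥ x,
    fun t ht => hasDerivWithinAt_quad ?_ x, fun t ht => ?_⟩
  · have hd := transMat_hasDeriv (A := A) hR hS hQ ht
    refine (((hasDerivWithinAt_transpose hd).mul_const P⁻¹).fun_mul hd).congr_deriv ?_
    have e : R = -(A * P) - P * Aᵀ + P * S * P := by
      rw [← sub_eq_zero, ← h, ricc]; abel
    have eZ : (Z t)ᵀ = (transMat A R S t Q)ᵀ * P⁻¹ := by
      simp only [hZ]; rw [Matrix.transpose_mul, hPi]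
    have hΦ : riccFlow A R S t Q = P + U t := by simp only [hU]; abel
    rw [hΦ]
    have s1 : (A - (P + U t) * S)ᵀ = Aᵀ - S * (P + U t) := by
      rw [Matrix.transpose_sub, Matrix.transpose_mul, transpose_eq_of_posSemidef hS,
        Matrix.transpose_add, hPt, hUt t ht]
    rw [Matrix.transpose_mul, s1]
    have s2 : (transMat A R S t Q)ᵀ = (Z t)ᵀ * P := by rw [eZ, mul_assoc, e1, mul_one]
    rw [s2, hE t]
    have : (Z t)ᵀ * P * (Aᵀ - S * (P + U t)) * P⁻¹ * (P * Z t) +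
        (Z t)ᵀ * P * P⁻¹ * ((A - (P + U t) * S) * (P * Z t)) =
        (Z t)ᵀ * P * (Aᵀ - S * (P + U t)) * (P⁻¹ * P) * Z t +
        (Z t)ᵀ * (P * P⁻¹) * ((A - (P + U t) * S) * (P * Z t)) := by noncomm_ring
    rw [this, e1, e2]
    generalize Z t = z
    generalize U t = u
    rw [e]
    noncomm_ring
  · have eq1 : x ⬝ᵥ ((transMat A R S t Q)ᵀ * P⁻¹ * transMat A R S t Q) *ᵥ x =
        (Z t *ᵥ x) ⬝ᵥ P *ᵥ (Z t *ᵥ x) := by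
      rw [← quad_conj, hE t, Matrix.transpose_mul, hPt]
      congr 2
      calc (Z t)ᵀ * P * P⁻¹ * (P * Z t) = (Z t)ᵀ * (P * P⁻¹) * P * Z t := by noncomm_ring
        _ = _ := by rw [e2, mul_one]
    rw [eq1]
    simp only [quad_conj]
    generalize Z t *ᵥ x = z
    have q1 := quad_nonneg hε z
    have q2 := quad_nonneg (posSemidef_mul_mul_self hS (U := P + U t)
      (by rw [Matrix.transpose_add, hPt, hUt t ht])) z
    have q3 := quad_le (U t * S * U t) z
    have q4 : ‖U t * S * U t‖ ≤ ‖S‖ * ‖U t‖ ^ 2 := by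
      refine (norm_mul_le _ _).trans ?_
      nlinarith [norm_mul_le (U t) S, norm_nonneg (U t)]
    have q5 : ‖U t * S * U t‖ * (z ⬝ᵥ z) ≤ ‖S‖ * ‖U t‖ ^ 2 * (l * (z ⬝ᵥ P *ᵥ z)) :=
      mul_le_mul q4 (hl z) (dotProduct_self_nonneg' z) (by positivity)
    simp only [Matrix.add_mulVec, Matrix.sub_mulVec, Matrix.neg_mulVec, Matrix.smul_mulVec,
      dotProduct_add, dotProduct_sub, dotProduct_neg, dotProduct_smul, smul_eq_mul] at q1 ⊢
    have : ‖riccFlow A R S t Q - P‖ = ‖U t‖ := rfl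
    rw [this]
    linarith

/-- A scalar Grönwall estimate whose coefficient is `-ε/2` up to an exponentially small term. -/
lemma le_of_deriv_le_exp {f f' : ℝ → ℝ} {ε k : ℝ} (hε : 0 < ε)
    (h : ∀ t, 0 ≤ t → HasDerivWithinAt f (f' t) (Set.Ici 0) t)
    (hle : ∀ t, 0 ≤ t → f' t ≤ (-(ε / 2) + k * Real.exp (-ε * t)) * f t) (hk : 0 ≤ k)
    (hf : ∀ t, 0 ≤ t → 0 ≤ f t) {t : ℝ} (ht : 0 ≤ t) :
    f t ≤ Real.exp (k / ε) * Real.exp (-(ε / 2) * t) * f 0 := by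
  set w : ℝ → ℝ := fun t => Real.exp (ε / 2 * t + k / ε * Real.exp (-ε * t)) with hw
  have hwd : ∀ t, HasDerivAt w (w t * (ε / 2 - k * Real.exp (-ε * t))) t := fun t => by
    have h1 := ((hasDerivAt_id t).const_mul (-ε)).exp.const_mul (k / ε)
    have h2 := (((hasDerivAt_id t).const_mul (ε / 2)).fun_add h1).exp
    simp only [id_eq, mul_one] at h2
    refine h2.congr_deriv ?_
    simp only [hw]
    field_simp
    ring
  have hmono := monotoneOn_of_hasDerivWithinAt_Ici (f := fun t => -(w t * f t))
    (f' := fun t => -(w t * (ε / 2 - k * Real.exp (-ε * t)) * f t + w t * f' t))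
    (fun t ht => ((hwd t).hasDerivWithinAt.fun_mul (h t ht)).fun_neg) (fun t ht => by
      have h1 : 0 < w t := Real.exp_pos _
      nlinarith [hle t ht])
  have h2 := hmono Set.self_mem_Ici ht ht
  simp only [neg_le_neg_iff] at h2
  have h3 : w 0 = Real.exp (k / ε) := by simp [hw]
  have h4 : Real.exp (ε / 2 * t) ≤ w t := Real.exp_le_exp.2 (by
    have : 0 ≤ k / ε * Real.exp (-ε * t) := by positivity
    linarith)
  rw [h3] at h2
  have h5 : Real.exp (ε / 2 * t) * f t ≤ Real.exp (k / ε) * f 0 :=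
    (mul_le_mul_of_nonneg_right h4 (hf t ht)).trans h2
  have h6 : Real.exp (-(ε / 2) * t) * Real.exp (ε / 2 * t) = 1 := by
    rw [← Real.exp_add]; simp
  calc f t = Real.exp (-(ε / 2) * t) * (Real.exp (ε / 2 * t) * f t) := by
        rw [← mul_assoc, h6, one_mul]
    _ ≤ Real.exp (-(ε / 2) * t) * (Real.exp (k / ε) * f 0) :=
        mul_le_mul_of_nonneg_left h5 (Real.exp_pos _).le
    _ = _ := by ring

/-- The transition matrices decay exponentially, at a rate that does not depend on the initial
matrix. -/
theorem exists_transitionRate {A R S P : SqMat r} (hR : R.PosDef) (hS : S.PosSemidef)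
    (hP : P.PosDef) (h : ricc A R S P = 0)
    (hlim : Filter.Tendsto (fun t => riccFlow A R S t 0) Filter.atTop (nhds P)) :
    ∃ ν : ℝ, 0 < ν ∧ IsTransitionRate A R S ν := by
  have z : (0 : SqMat r).PosSemidef := Matrix.PosSemidef.zero
  have hPt := transpose_eq_of_posSemidef hP.posSemidef
  have hRt := transpose_eq_of_posSemidef hR.posSemidef
  have hu : IsUnit P.det := (Matrix.isUnit_iff_isUnit_det P).1 hP.isUnit
  obtain ⟨l, hl0, hl⟩ := exists_pos_dotProduct_le_quad hP
  obtain ⟨ρ, hρ0, hρ⟩ := exists_pos_dotProduct_le_quad hR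
  set ε : ℝ := (ρ * (‖P‖ + 1))⁻¹ with hεdef
  have hε0 : 0 < ε := by positivity
  have hε : (R - ε • P).PosSemidef := posSemidef_iff.2 ⟨by simp [hPt, hRt], fun x => by
    have h1 := quad_le P x
    have h2 := hρ x
    have h3 : ε * (ρ * (‖P‖ + 1)) = 1 := inv_mul_cancel₀ (by positivity)
    have h4 : x ⬝ᵥ P *ᵥ x ≤ (‖P‖ + 1) * (ρ * (x ⬝ᵥ R *ᵥ x)) :=
      (h1.trans (mul_le_mul_of_nonneg_right (by linarith) (dotProduct_self_nonneg' x))).trans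
        (mul_le_mul_of_nonneg_left h2 (by positivity))
    have h5 := mul_le_mul_of_nonneg_left h4 hε0.le
    rw [Matrix.sub_mulVec, dotProduct_sub, Matrix.smul_mulVec, dotProduct_smul, smul_eq_mul]
    have h6 : ε * ((‖P‖ + 1) * (ρ * (x ⬝ᵥ R *ᵥ x))) = x ⬝ᵥ R *ᵥ x := by
      calc _ = ε * (ρ * (‖P‖ + 1)) * (x ⬝ᵥ R *ᵥ x) := by ring
        _ = _ := by rw [h3, one_mul]
    linarith⟩
  -- the distance to `P` of the trajectory from `0`, squared, is eventually negligible
  obtain ⟨k, hk0, hk⟩ : ∃ k : ℝ, 0 ≤ k ∧ ∀ t, 0 ≤ t →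
      8 * (l * ‖S‖) * ‖P - riccFlow A R S t 0‖ ^ 2 ≤ ε / 2 + k * Real.exp (-ε * t) := by
    have h1 : Filter.Tendsto (fun t => 8 * (l * ‖S‖) * ‖P - riccFlow A R S t 0‖ ^ 2)
        Filter.atTop (nhds (8 * (l * ‖S‖) * ‖P - P‖ ^ 2)) :=
      ((hlim.const_sub P).norm.pow 2).const_mul _
    rw [sub_self, norm_zero, zero_pow two_ne_zero, mul_zero] at h1
    obtain ⟨T, hT⟩ := Filter.eventually_atTop.1 (h1.eventually_le_const (half_pos hε0))
    refine ⟨8 * (l * ‖S‖) * ‖P‖ ^ 2 * Real.exp (ε * T), by positivity, fun t ht => ?_⟩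
    rcases le_total T t with hTt | hTt
    · have := hT t hTt
      have : 0 ≤ 8 * (l * ‖S‖) * ‖P‖ ^ 2 * Real.exp (ε * T) * Real.exp (-ε * t) := by positivity
      linarith
    · have hle : ‖P - riccFlow A R S t 0‖ ≤ ‖P‖ := by
        have h2 := riccFlow_mono (A := A) hR hS z hP.posSemidef (by simpa using hP.posSemidef) ht
        rw [riccFlow_eq_self hR hS hP.posSemidef h ht] at h2
        refine norm_le_norm_of_posSemidef_sub h2 ?_
        rw [sub_sub_cancel]
        exact riccFlow_posSemidef hR hS z ht
      have h3 : 1 ≤ Real.exp (ε * T) * Real.exp (-ε * t) := by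
        rw [← Real.exp_add]
        exact Real.one_le_exp (by nlinarith)
      have h4 : 8 * (l * ‖S‖) * ‖P - riccFlow A R S t 0‖ ^ 2 ≤ 8 * (l * ‖S‖) * ‖P‖ ^ 2 := by
        gcongr
      have h5 := mul_le_mul_of_nonneg_left h3 (show 0 ≤ 8 * (l * ‖S‖) * ‖P‖ ^ 2 by positivity)
      linarith
  set k₂ : ℝ := 2 * (l * ‖S‖) * (l * ‖P‖) ^ 2 with hk₂
  set kk : ℝ → ℝ := fun a => k + k₂ * max a 0 ^ 2 with hkk
  -- the quadratic form decays at rate `ε / 2`, hence the norm at rate `ε / 4 = 2 ν`; the `max` in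
  -- `kk` makes the prefactor monotone on negative arguments too
  refine ⟨ε / 8, by positivity,
    fun a => Real.sqrt (‖P‖ * ‖P⁻¹‖) * Real.exp (kk a / ε / 2), fun a b hab => ?_,
    fun Q hQ t ht => ?_⟩
  · have : max a 0 ≤ max b 0 := max_le_max_right 0 hab
    simp only [hkk]
    gcongr
  · have hcP : ((l * ‖Q‖) • P - Q).PosSemidef := posSemidef_iff.2
      ⟨by simp [hPt, transpose_eq_of_posSemidef hQ], fun x => by
        have h1 := quad_le Q x
        have h2 := mul_le_mul_of_nonneg_left (hl x) (norm_nonneg Q)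
        rw [Matrix.sub_mulVec, dotProduct_sub, Matrix.smul_mulVec, dotProduct_smul, smul_eq_mul]
        linarith⟩
    have hUb : ∀ t, 0 ≤ t → -ε + l * ‖S‖ * ‖riccFlow A R S t Q - P‖ ^ 2 ≤
        -(ε / 2) + kk ‖Q‖ * Real.exp (-ε * t) := fun t ht => by
      have h1 := norm_riccFlow_sub_stationary_le hR hS hP h hQ (by positivity) hε hcP ht
      have h2 := hk t ht
      set u := ‖riccFlow A R S t Q - P‖
      set v := ‖P - riccFlow A R S t 0‖
      set e := Real.exp (-ε * t)
      have he0 : 0 < e := Real.exp_pos _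
      have he1 : e ≤ 1 := Real.exp_le_one_iff.2 (by nlinarith)
      have h3 : u ^ 2 ≤ 2 * (l * ‖Q‖ * e * ‖P‖) ^ 2 + 8 * v ^ 2 := by
        have hu0 : 0 ≤ u := norm_nonneg _
        nlinarith [sq_nonneg (l * ‖Q‖ * e * ‖P‖ - 2 * v)]
      have h4 := mul_le_mul_of_nonneg_left h3 (show 0 ≤ l * ‖S‖ by positivity)
      have h5 : e ^ 2 ≤ e := by nlinarith
      have h6 := mul_le_mul_of_nonneg_left h5 (show 0 ≤ k₂ * ‖Q‖ ^ 2 by positivity)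
      have h7 : kk ‖Q‖ = k + k₂ * ‖Q‖ ^ 2 := by
        simp only [hkk]; rw [max_eq_left (norm_nonneg Q)]
      have h8 : l * ‖S‖ * (2 * (l * ‖Q‖ * e * ‖P‖) ^ 2) = k₂ * ‖Q‖ ^ 2 * e ^ 2 := by
        rw [hk₂]; ring
      rw [h7]
      nlinarith
    have hpsd : ∀ t, ((transMat A R S t Q)ᵀ * P⁻¹ * transMat A R S t Q).PosSemidef := fun t =>
      posSemidef_transpose_mul_mul hP.inv.posSemidef _
    refine norm_le_of_dotProduct_mulVec_self_le (by positivity) fun x => ?_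
    obtain ⟨f', hf', hf'le⟩ := exists_lyapunov_deriv hR hS hP h hQ hl hε x
    have key := le_of_deriv_le_exp hε0 hf' (fun t ht => (hf'le t ht).trans
      (mul_le_mul_of_nonneg_right (hUb t ht) (quad_nonneg (hpsd t) x)))
      (show 0 ≤ kk ‖Q‖ by positivity) (fun t _ => quad_nonneg (hpsd t) x) ht
    rw [quad_conj, quad_conj, transMat_zero hR hS hQ, Matrix.one_mulVec] at key
    have h1 := dotProduct_mulVec_self_le_quad hP.posSemidef (P⁻¹ *ᵥ (transMat A R S t Q *ᵥ x))
    rw [Matrix.mulVec_mulVec _ P, Matrix.mul_nonsing_inv P hu, Matrix.one_mulVec,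
      dotProduct_comm (P⁻¹ *ᵥ _)] at h1
    have h2 := quad_le P⁻¹ x
    have e1 : (Real.sqrt (‖P‖ * ‖P⁻¹‖) * Real.exp (kk ‖Q‖ / ε / 2) *
        Real.exp (-2 * (ε / 8) * t)) ^ 2 =
        ‖P‖ * ‖P⁻¹‖ * (Real.exp (kk ‖Q‖ / ε) * Real.exp (-(ε / 2) * t)) := by
      rw [mul_pow, mul_pow, Real.sq_sqrt (by positivity), ← Real.exp_nat_mul, ← Real.exp_nat_mul,
        mul_assoc]
      congr 3
      all_goals push_cast; ring_nf
    rw [e1]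
    refine h1.trans ((mul_le_mul_of_nonneg_left key (norm_nonneg P)).trans ?_)
    calc _ ≤ ‖P‖ * (Real.exp (kk ‖Q‖ / ε) * Real.exp (-(ε / 2) * t) * (‖P⁻¹‖ * (x ⬝ᵥ x))) := by
          gcongr
      _ = _ := by ring

/-! ### The algebra of the projection -/

/-- The commutator `X ↦ W X - X W`. -/
noncomputable def adMat (W : SqMat r) : SqMat r →ₗ[ℝ] SqMat r :=
  LinearMap.mulLeft ℝ W - LinearMap.mulRight ℝ W

lemma adMat_apply (W X : SqMat r) : adMat W X = W * X - X * W := rfl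

lemma adMat_transpose {W X : SqMat r} (hW : Wᵀ = -W) (hX : Xᵀ = X) :
    (adMat W X)ᵀ = adMat W X := by
  simp only [adMat_apply, Matrix.transpose_sub, Matrix.transpose_mul, hW, hX]
  noncomm_ring

/-- On symmetric matrices the commutator with a skew matrix is skew for the trace form, so that
it vanishes where its square does. -/
lemma adMat_eq_zero {W Y : SqMat r} (hW : Wᵀ = -W) (hY : Yᵀ = Y)
    (h : adMat W (adMat W Y) * Y = 0) : adMat W Y = 0 := by
  set V := adMat W Y with hV
  have hVt : Vᵀ = V := adMat_transpose hW hY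
  have h1 : Matrix.trace (Vᵀ * V) = 0 := by
    have h2 : Matrix.trace (adMat W V * Y) = -Matrix.trace (V * V) := by
      have h3 : V * V = V * W * Y - V * Y * W := by
        nth_rewrite 2 [hV]; rw [adMat_apply]; noncomm_ring
      rw [h3, adMat_apply, sub_mul, Matrix.trace_sub, Matrix.trace_sub, mul_assoc W,
        Matrix.trace_mul_comm W]
      ring
    rw [hVt]
    rw [h, Matrix.trace_zero] at h2
    linarith
  have := (Matrix.trace_conjTranspose_mul_self_eq_zero_iff (A := V)).1
  rw [Matrix.conjTranspose_eq_transpose_of_trivial] at this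
  exact this h1

/-- The space of symmetric matrices. -/
def symMat (r : ℕ) : Submodule ℝ (SqMat r) where
  carrier := {X | Xᵀ = X}
  add_mem' := fun {X Y} hX hY => by
    show (X + Y)ᵀ = X + Y
    rw [Matrix.transpose_add, show Xᵀ = X from hX, show Yᵀ = Y from hY]
  zero_mem' := Matrix.transpose_zero
  smul_mem' := fun c X hX => by
    show (c • X)ᵀ = c • X
    rw [Matrix.transpose_smul, show Xᵀ = X from hX]

/-- A symmetric matrix splits into one commuting with the skew matrix `W` and a commutator. -/
lemma exists_add_adMat {W X : SqMat r} (hW : Wᵀ = -W) (hX : Xᵀ = X) :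
    ∃ K Z : SqMat r, Kᵀ = K ∧ Zᵀ = Z ∧ adMat W K = 0 ∧ X = K + adMat W Z := by
  let T : symMat r →ₗ[ℝ] symMat r :=
    (adMat W).restrict fun Y hY => adMat_transpose hW hY
  have hdisj : Disjoint (LinearMap.ker T) (LinearMap.range T) := by
    rw [Submodule.disjoint_def]
    rintro _ hx ⟨y, rfl⟩
    have h1 : adMat W (adMat W y) = 0 := congrArg Subtype.val (LinearMap.mem_ker.1 hx)
    exact Subtype.ext (adMat_eq_zero hW y.2
      ((congrArg (· * (y : SqMat r)) h1).trans (zero_mul _)))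
  have htop := Submodule.eq_top_of_disjoint _ _
    (by rw [add_comm, LinearMap.finrank_range_add_finrank_ker]) hdisj
  have hmem : (⟨X, hX⟩ : symMat r) ∈ LinearMap.ker T ⊔ LinearMap.range T := by
    rw [htop]; exact Submodule.mem_top
  obtain ⟨k, hk, _, ⟨z, rfl⟩, hkz⟩ := Submodule.mem_sup.1 hmem
  exact ⟨k, z, k.2, z.2, congrArg Subtype.val (LinearMap.mem_ker.1 hk),
    (congrArg Subtype.val hkz).symm⟩

end RiccatiStability

namespace IsOrthogonalProjectionModel

open RiccatiStability

variable {r : ℕ} {A R S : SqMat r} {𝓑 : NonUnitalSubring (SqMat r)} {π : SqMat r →ₗ[ℝ] SqMat r}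
  (h : IsOrthogonalProjectionModel A R S 𝓑 π)
include h

lemma map_A_mem : A ∈ 𝓑 := h.map_A ▸ h.map_mem A

lemma map_At_mem : Aᵀ ∈ 𝓑 := h.map_At ▸ h.map_mem Aᵀ

lemma map_S_mem : S ∈ 𝓑 := h.map_S ▸ h.map_mem S

/-- `π` is a homomorphism of Jordan modules over `𝓑`. -/
lemma map_jordan {B : SqMat r} (hB : B ∈ 𝓑) (X : SqMat r) :
    π (B * X + X * B) = B * π X + π X * B := by
  have h1 := h.orthogonal X B hB
  have h2 := h.map_eq _ (𝓑.add_mem (𝓑.mul_mem hB (h.map_mem X)) (𝓑.mul_mem (h.map_mem X) hB))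
  rw [← h2, ← sub_eq_zero, ← map_sub, ← h1]
  congr 1
  noncomm_ring

/-- Left multiplication by a commutator `[W, B]` of elements of `𝓑` is a combination of Jordan
products, since `[[W, B], X] = W ∘ (B ∘ X) - B ∘ (W ∘ X)` for `U ∘ V = U V + V U`. -/
lemma map_adMat_mul {W B : SqMat r} (hW : W ∈ 𝓑) (hB : B ∈ 𝓑) (X : SqMat r) :
    π (adMat W B * X) = adMat W B * π X := by
  have hC : adMat W B ∈ 𝓑 := 𝓑.sub_mem (𝓑.mul_mem hW hB) (𝓑.mul_mem hB hW)
  have h1 := h.map_jordan hC X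
  have h2 : π (adMat W B * X - X * adMat W B) =
      adMat W B * π X - π X * adMat W B := by
    have e : ∀ X : SqMat r, adMat W B * X - X * adMat W B =
        (W * (B * X + X * B) + (B * X + X * B) * W) -
          (B * (W * X + X * W) + (W * X + X * W) * B) := fun X => by
      rw [adMat_apply]; noncomm_ring
    rw [e, e, map_sub, h.map_jordan hW, h.map_jordan hB, h.map_jordan hB, h.map_jordan hW]
  have h3 : (2 : ℝ) • π (adMat W B * X) = (2 : ℝ) • (adMat W B * π X) := by
    rw [← map_smul]
    have e1 : (2 : ℝ) • (adMat W B * X) = (adMat W B * X + X * adMat W B) +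
        (adMat W B * X - X * adMat W B) := by rw [two_smul]; abel
    rw [e1, map_add, h1, h2, two_smul]
    abel
  exact smul_right_injective _ two_ne_zero h3

/-- The square of a commutator is a Jordan polynomial, hence passes through `π`. -/
lemma map_adMat_sq {W : SqMat r} (hW : W ∈ 𝓑) (X : SqMat r) :
    π (adMat W (adMat W X)) = adMat W (adMat W (π X)) := by
  have e : ∀ X : SqMat r, adMat W (adMat W X) =
      (2 : ℝ) • ((W * W) * X + X * (W * W)) - (W * (W * X + X * W) + (W * X + X * W) * W) :=
    fun X => by simp only [adMat_apply, two_smul]; noncomm_ring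
  rw [e, e, map_sub, map_smul, h.map_jordan (𝓑.mul_mem hW hW), h.map_jordan hW, h.map_jordan hW]

lemma map_transpose {X : SqMat r} (hX : Xᵀ = X) : (π X)ᵀ = π X := by
  have h1 : ((‖X‖ : ℝ) • (1 : SqMat r)).PosSemidef := Matrix.PosSemidef.one.smul (norm_nonneg X)
  have h2 : (X + (‖X‖ : ℝ) • (1 : SqMat r)).PosSemidef := by
    refine posSemidef_iff.2 ⟨by simp [hX], fun x => ?_⟩
    rw [Matrix.add_mulVec, dotProduct_add, Matrix.smul_mulVec, dotProduct_smul,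
      Matrix.one_mulVec, smul_eq_mul]
    linarith [neg_le_of_abs_le (abs_quad_le X x)]
  have h3 := transpose_eq_of_posSemidef (h.positive _ h1)
  have h4 := transpose_eq_of_posSemidef (h.positive _ h2)
  rw [map_add, Matrix.transpose_add, h3] at h4
  exact add_right_cancel h4

/-- On symmetric matrices `π` commutes with the commutator `T = [W, ·]` of a skew `W ∈ 𝓑`.
The defect `δ = π T - T π` satisfies `δ T = -T δ`, and `δ (B X) = B δ X` for `B ∈ T 𝓑`; combining
the two gives `(T² B) δ X = 0` for all `B ∈ 𝓑`. With `B = δ X` this forces `T δ = 0`, so `δ`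
vanishes on the range of `T`. It also vanishes on the kernel of `T`, which together
with the range spans the symmetric matrices. -/
lemma map_adMat_of_skew {W : SqMat r} (hW : W ∈ 𝓑) (hWt : Wᵀ = -W) {X : SqMat r}
    (hX : Xᵀ = X) : π (adMat W X) = adMat W (π X) := by
  have hT𝓑 : ∀ B ∈ 𝓑, adMat W B ∈ 𝓑 := fun B hB =>
    𝓑.sub_mem (𝓑.mul_mem hW hB) (𝓑.mul_mem hB hW)
  have hTmul : ∀ B Y : SqMat r, adMat W (B * Y) =
      adMat W B * Y + B * adMat W Y := fun B Y => by
    simp only [adMat_apply]; noncomm_ring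
  set δ : SqMat r → SqMat r := fun Y => π (adMat W Y) - adMat W (π Y) with hδ
  have hδT : ∀ Y, δ (adMat W Y) = -adMat W (δ Y) := fun Y => by
    simp only [hδ, map_sub, h.map_adMat_sq hW]; abel
  have hδmul : ∀ B ∈ 𝓑, ∀ Y, δ (adMat W B * Y) = adMat W B * δ Y := fun B hB Y => by
    simp only [hδ]
    rw [hTmul, map_add, h.map_adMat_mul hW (hT𝓑 B hB), h.map_adMat_mul hW hB,
      h.map_adMat_mul hW hB, hTmul, mul_sub]
    abel
  have hkill : ∀ B ∈ 𝓑, ∀ Y, adMat W (adMat W B) * δ Y = 0 := fun B hB Y => by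
    have h1 := hδT (adMat W B * Y)
    have hadd : ∀ Y Z, δ (Y + Z) = δ Y + δ Z := fun Y Z => by
      simp only [hδ, map_add]; abel
    rw [hδmul B hB, hTmul, hTmul, hadd, hδmul _ (hT𝓑 B hB), hδmul B hB, hδT] at h1
    have h2 : (2 : ℝ) • (adMat W (adMat W B) * δ Y) = (2 : ℝ) • 0 := by
      rw [smul_zero, two_smul]
      rw [mul_neg, neg_add, ← sub_eq_add_neg, ← sub_eq_add_neg, sub_left_inj] at h1
      nth_rewrite 1 [h1]
      exact neg_add_cancel _
    exact smul_right_injective _ two_ne_zero h2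
  have hδt : ∀ Y, Yᵀ = Y → (δ Y)ᵀ = δ Y := fun Y hY => by
    simp only [hδ]
    rw [Matrix.transpose_sub, h.map_transpose (adMat_transpose hWt hY),
      adMat_transpose hWt (h.map_transpose hY)]
  have hδ𝓑 : ∀ Y, δ Y ∈ 𝓑 := fun Y => 𝓑.sub_mem (h.map_mem _) (hT𝓑 _ (h.map_mem _))
  obtain ⟨K, Z, hK, hZ, hK0, rfl⟩ := exists_add_adMat hWt hX
  have h1 : adMat W (δ Z) = 0 :=
    adMat_eq_zero hWt (hδt Z hZ) (hkill _ (hδ𝓑 Z) Z)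
  have h2 : δ (adMat W Z) = 0 := by rw [hδT, h1, neg_zero]
  have h3 : adMat W (π K) = 0 :=
    adMat_eq_zero hWt (h.map_transpose hK) (by
      rw [← h.map_adMat_sq hW, hK0, map_zero, map_zero, zero_mul])
  simp only [map_add, hK0, h3, zero_add]
  exact sub_eq_zero.1 h2

/-- The symmetrized form of the orthogonality property. -/
lemma map_lyapunov {B X : SqMat r} (hB : B ∈ 𝓑) (hBt : Bᵀ ∈ 𝓑) (hX : Xᵀ = X) :
    π (B * X + X * Bᵀ) = B * π X + π X * Bᵀ := by
  have e : ∀ X : SqMat r, (2 : ℝ) • (B * X + X * Bᵀ) =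
      ((B + Bᵀ) * X + X * (B + Bᵀ)) + adMat (B - Bᵀ) X := fun X => by
    rw [adMat_apply, two_smul]; noncomm_ring
  have h1 : (2 : ℝ) • π (B * X + X * Bᵀ) = (2 : ℝ) • (B * π X + π X * Bᵀ) := by
    rw [← map_smul, e, e, map_add, h.map_jordan (𝓑.add_mem hB hBt),
      h.map_adMat_of_skew (𝓑.sub_mem hB hBt) (by simp) hX]
  exact smul_right_injective _ two_ne_zero h1

end IsOrthogonalProjectionModel

namespace RiccatiStability

variable {r : ℕ}

/-! ### The projected flow -/

lemma norm_map_le (π : SqMat r →ₗ[ℝ] SqMat r) (X : SqMat r) :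
    ‖π X‖ ≤ ‖LinearMap.toContinuousLinearMap π‖ * ‖X‖ :=
  (LinearMap.toContinuousLinearMap π).le_opNorm X

lemma norm_mul_mul_le (X Y Z : SqMat r) : ‖X * Y * Z‖ ≤ ‖X‖ * ‖Y‖ * ‖Z‖ :=
  (norm_mul_le _ _).trans (mul_le_mul_of_nonneg_right (norm_mul_le _ _) (norm_nonneg _))

lemma norm_mul_mul_transpose_le (X Y Z : SqMat r) : ‖X * Y * Zᵀ‖ ≤ ‖X‖ * ‖Y‖ * ‖Z‖ := by
  simpa only [norm_transpose] using norm_mul_mul_le X Y Zᵀ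

/-- Solutions of the projected equation are unique, among all matrix-valued curves. -/
lemma riccProj_unique {A R S : SqMat r} (π : SqMat r →ₗ[ℝ] SqMat r) {Q : SqMat r}
    {X Y : ℝ → SqMat r} (hX : IsForwardSolution (fun _ => riccProj A R S π) Q X)
    (hY : IsForwardSolution (fun _ => riccProj A R S π) Q Y) {t : ℝ} (ht : 0 ≤ t) :
    X t = Y t := by
  set p := ‖LinearMap.toContinuousLinearMap π‖ with hp
  have cX := IsForwardSolution.continuousOn hX
  have cY := IsForwardSolution.continuousOn hY
  have cπ : Continuous π := LinearMap.continuous_of_finiteDimensional π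
  have cX' : ContinuousOn (fun t => π (X t)) (Set.Ici 0) := cπ.comp_continuousOn cX
  have cY' : ContinuousOn (fun t => π (Y t)) (Set.Ici 0) := cπ.comp_continuousOn cY
  refine forwardSolution_unique hX hY (k := fun t =>
    ‖A - π (X t) * S‖ + ‖(A - π (X t) * S)ᵀ‖ + p * ‖S‖ * ‖Y t‖ + ‖Y t‖ * (p * ‖S‖) +
      ‖π (X t)‖ * ‖S‖ * p + p * ‖S‖ * ‖π (Y t)‖) ?_ (fun t _ => ?_) ht
  · simp only [norm_transpose]
    fun_prop
  · generalize X t = X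
    generalize Y t = Y
    set D := X - Y with hD
    have hδ : ‖π D‖ ≤ p * ‖D‖ := norm_map_le π D
    have e : riccProj A R S π X - riccProj A R S π Y =
        ((A - π X * S) * D + D * (A - π X * S)ᵀ) - π D * S * Y - Y * (π D * S)ᵀ +
          π X * S * π D + π D * S * π Y := by
      rw [hD, map_sub]
      simp only [riccProj, Matrix.transpose_sub, sub_mul, mul_sub]
      abel
    rw [e]
    have b1 := norm_mul_add_mul_le (A - π X * S) (A - π X * S)ᵀ D
    have b2 : ‖π D * S * Y‖ ≤ p * ‖D‖ * ‖S‖ * ‖Y‖ := (norm_mul_mul_le _ _ _).trans (by gcongr)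
    have b3 : ‖Y * (π D * S)ᵀ‖ ≤ ‖Y‖ * (p * ‖D‖ * ‖S‖) := by
      refine (norm_mul_le _ _).trans ?_
      rw [norm_transpose]
      have := norm_mul_le (π D) S
      gcongr
      exact this.trans (by gcongr)
    have b4 : ‖π X * S * π D‖ ≤ ‖π X‖ * ‖S‖ * (p * ‖D‖) :=
      (norm_mul_mul_le _ _ _).trans (by gcongr)
    have b5 : ‖π D * S * π Y‖ ≤ p * ‖D‖ * ‖S‖ * ‖π Y‖ :=
      (norm_mul_mul_le _ _ _).trans (by gcongr)
    refine (norm_add_le_of_le (norm_add_le_of_le (norm_sub_le_of_le (norm_sub_le_of_le b1 b2) b3)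
      b4) b5).trans (le_of_eq ?_)
    ring

lemma transport_hasDeriv {A R S Q : SqMat r} (hR : R.PosDef) (hS : S.PosSemidef)
    (hQ : Q.PosSemidef) (D : SqMat r) {t : ℝ} (ht : 0 ≤ t) :
    HasDerivWithinAt (fun t => transMat A R S t Q * D * (transMat A R S t Q)ᵀ)
      ((A - riccFlow A R S t Q * S) * (transMat A R S t Q * D * (transMat A R S t Q)ᵀ) +
        (transMat A R S t Q * D * (transMat A R S t Q)ᵀ) * (A - riccFlow A R S t Q * S)ᵀ)
      (Set.Ici 0) t := by
  have hd := transMat_hasDeriv (A := A) hR hS hQ ht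
  refine ((hd.mul_const D).fun_mul (hasDerivWithinAt_transpose hd)).congr_deriv ?_
  rw [Matrix.transpose_mul]
  noncomm_ring

section Model

variable {A R S : SqMat r} {𝓑 : NonUnitalSubring (SqMat r)} {π : SqMat r →ₗ[ℝ] SqMat r}
  (h : IsOrthogonalProjectionModel A R S 𝓑 π) (hR : R.PosDef) (hS : S.PosSemidef)
  {Q : SqMat r} (hQ : Q.PosSemidef)
include h hR hS hQ

/-- The Riccati flow preserves the range of `π`: with `D = Y - π Y`, the orthogonality property
leaves only terms of `∂ₜD - (A - π(Y) S) D - D (A - π(Y) S)ᵀ` that are quadratic in `D`. -/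
lemma map_riccFlow (hπQ : π Q = Q) {t : ℝ} (ht : 0 ≤ t) :
    π (riccFlow A R S t Q) = riccFlow A R S t Q := by
  set p := ‖LinearMap.toContinuousLinearMap π‖ with hp
  have cY := riccFlow_continuousOn (A := A) hR hS hQ
  have cπ : Continuous π := LinearMap.continuous_of_finiteDimensional π
  have cY' : ContinuousOn (fun t => π (riccFlow A R S t Q)) (Set.Ici 0) :=
    cπ.comp_continuousOn cY
  have key := eq_zero_of_norm_deriv_le
    (f := fun t => riccFlow A R S t Q - π (riccFlow A R S t Q))
    (f' := fun t => ricc A R S (riccFlow A R S t Q) - π (ricc A R S (riccFlow A R S t Q)))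
    (k := fun t => ‖A - π (riccFlow A R S t Q) * S‖ + ‖(A - π (riccFlow A R S t Q) * S)ᵀ‖ +
      (1 + p) * (‖riccFlow A R S t Q - π (riccFlow A R S t Q)‖ * ‖S‖))
    (by simp only [norm_transpose]; fun_prop)
    (fun t ht => (riccFlow_hasDeriv hR hS hQ ht).fun_sub
      (hasDerivWithinAt_linear π (riccFlow_hasDeriv hR hS hQ ht))) (fun t ht => ?_)
    (by simp [riccFlow_zero hR hS hQ, hπQ]) ht
  · exact (sub_eq_zero.1 key).symm
  · have hYt := riccFlow_transpose (A := A) hR hS hQ ht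
    revert hYt
    generalize riccFlow A R S t Q = Y
    intro hYt
    have hπt := h.map_transpose hYt
    have hSt := transpose_eq_of_posSemidef hS
    set D := Y - π Y with hD
    have hB : A - π Y * S ∈ 𝓑 := 𝓑.sub_mem h.map_A_mem (𝓑.mul_mem (h.map_mem _) h.map_S_mem)
    have hBt : (A - π Y * S)ᵀ ∈ 𝓑 := by
      rw [Matrix.transpose_sub, Matrix.transpose_mul, hSt, hπt]
      exact 𝓑.sub_mem h.map_At_mem (𝓑.mul_mem h.map_S_mem (h.map_mem _))
    have hDt : Dᵀ = D := by rw [hD, Matrix.transpose_sub, hYt, hπt]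
    have hπD : π D = 0 := by rw [hD, map_sub, h.map_eq _ (h.map_mem Y), sub_self]
    have e1 : ricc A R S Y = ricc A R S (π Y) +
        ((A - π Y * S) * D + D * (A - π Y * S)ᵀ) - D * S * D := by
      rw [Matrix.transpose_sub, Matrix.transpose_mul, hSt, hπt, hD]
      simp only [ricc]
      noncomm_ring
    have e2 : π (ricc A R S (π Y)) = ricc A R S (π Y) := by
      have hm : ∀ B C, B ∈ 𝓑 → C ∈ 𝓑 → B * C ∈ 𝓑 := fun _ _ => 𝓑.mul_mem
      refine h.map_eq _ (𝓑.add_mem (𝓑.sub_mem (𝓑.add_mem ?_ ?_) ?_) (h.map_R ▸ h.map_mem R))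
      · exact hm _ _ h.map_A_mem (h.map_mem _)
      · exact hm _ _ (h.map_mem _) h.map_At_mem
      · exact hm _ _ (hm _ _ (h.map_mem _) h.map_S_mem) (h.map_mem _)
    have e3 : ricc A R S Y - π (ricc A R S Y) =
        ((A - π Y * S) * D + D * (A - π Y * S)ᵀ) - D * S * D + π (D * S * D) := by
      rw [e1, map_sub, map_add, e2, h.map_lyapunov hB hBt hDt, hπD]
      noncomm_ring
    rw [e3]
    have b1 := norm_mul_add_mul_le (A - π Y * S) (A - π Y * S)ᵀ D
    have b2 := norm_mul_mul_le D S D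
    have b3 : ‖π (D * S * D)‖ ≤ p * (‖D‖ * ‖S‖ * ‖D‖) :=
      (norm_map_le π _).trans (by gcongr)
    refine (norm_add_le_of_le (norm_sub_le_of_le b1 b2) b3).trans (le_of_eq ?_)
    ring

/-- The part of `Q` orthogonal to the range of `π` stays so under transport by `E_t(π(Q))`. -/
lemma map_transport {t : ℝ} (ht : 0 ≤ t) :
    π (transMat A R S t (π Q) * (Q - π Q) * (transMat A R S t (π Q))ᵀ) = 0 := by
  have hπQ := h.positive Q hQ
  have hππ : π (π Q) = π Q := h.map_eq _ (h.map_mem Q)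
  have cY := riccFlow_continuousOn (A := A) hR hS hπQ
  refine eq_zero_of_lyapunov
    (V := fun t => π (transMat A R S t (π Q) * (Q - π Q) * (transMat A R S t (π Q))ᵀ))
    (B := fun t => A - riccFlow A R S t (π Q) * S) (D := fun t => Aᵀ - S * riccFlow A R S t (π Q))
    (by fun_prop) (by fun_prop) (fun t ht => ?_) ?_ ht
  · refine (hasDerivWithinAt_linear π (transport_hasDeriv hR hS hπQ _ ht)).congr_deriv ?_
    have hYm : riccFlow A R S t (π Q) ∈ 𝓑 := map_riccFlow h hR hS hπQ hππ ht ▸ h.map_mem _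
    have hBt : (A - riccFlow A R S t (π Q) * S)ᵀ = Aᵀ - S * riccFlow A R S t (π Q) := by
      rw [Matrix.transpose_sub, Matrix.transpose_mul, transpose_eq_of_posSemidef hS,
        riccFlow_transpose hR hS hπQ ht]
    rw [h.map_lyapunov (𝓑.sub_mem h.map_A_mem (𝓑.mul_mem hYm h.map_S_mem))
      (by rw [hBt]; exact 𝓑.sub_mem h.map_At_mem (𝓑.mul_mem h.map_S_mem hYm))
      (by simp only [Matrix.transpose_mul, Matrix.transpose_transpose, Matrix.transpose_sub,
        transpose_eq_of_posSemidef hQ, transpose_eq_of_posSemidef hπQ, mul_assoc]), hBt]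
  · simp only [transMat_zero hR hS hπQ]
    rw [Matrix.transpose_one, mul_one, one_mul, map_sub, hππ, sub_self]

/-- Explicit solution of the projected equation: the Riccati flow of `π(Q)`, to which `Q - π(Q)`,
transported by the transition matrices, is added. -/
lemma isForwardSolution_riccProj : IsForwardSolution (fun _ => riccProj A R S π) Q
    (fun t => riccFlow A R S t (π Q) +
      transMat A R S t (π Q) * (Q - π Q) * (transMat A R S t (π Q))ᵀ) := by
  have hπQ := h.positive Q hQ
  refine ⟨?_, fun t ht => ?_⟩
  · simp only [riccFlow_zero hR hS hπQ, transMat_zero hR hS hπQ]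
    rw [Matrix.transpose_one, mul_one, one_mul, add_sub_cancel]
  · refine ((riccFlow_hasDeriv hR hS hπQ ht).fun_add
      (transport_hasDeriv hR hS hπQ (Q - π Q) ht)).congr_deriv ?_
    beta_reduce
    have e1 := map_transport h hR hS hQ ht
    have e2 := map_riccFlow h hR hS hπQ (h.map_eq _ (h.map_mem Q)) ht
    have e3 := riccFlow_transpose (A := A) hR hS hπQ ht
    revert e1 e2 e3
    generalize transMat A R S t (π Q) * (Q - π Q) * (transMat A R S t (π Q))ᵀ = Z
    generalize riccFlow A R S t (π Q) = Y
    intro e1 e2 e3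
    have e : π (Y + Z) = Y := by rw [map_add, e1, e2, add_zero]
    simp only [riccProj, ricc, e, Matrix.transpose_sub, Matrix.transpose_mul, e3,
      transpose_eq_of_posSemidef hS]
    noncomm_ring

lemma isWellPosed_riccProj : IsWellPosed (fun _ => riccProj A R S π) Q :=
  isWellPosed_of_exists_unique ⟨_, isForwardSolution_riccProj h hR hS hQ⟩
    fun _ _ hX hY _ ht => riccProj_unique π hX hY ht

lemma riccProjFlow_eq {t : ℝ} (ht : 0 ≤ t) : riccProjFlow A R S π t Q =
    riccFlow A R S t (π Q) + transMat A R S t (π Q) * (Q - π Q) * (transMat A R S t (π Q))ᵀ :=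
  ((isWellPosed_riccProj h hR hS hQ).2 _ (isForwardSolution_riccProj h hR hS hQ) t ht).symm

lemma map_riccProjFlow {t : ℝ} (ht : 0 ≤ t) :
    π (riccProjFlow A R S π t Q) = riccFlow A R S t (π Q) := by
  rw [riccProjFlow_eq h hR hS hQ ht, map_add, map_transport h hR hS hQ ht, add_zero,
    map_riccFlow h hR hS (h.positive Q hQ) (h.map_eq _ (h.map_mem Q)) ht]

lemma riccProjFlow_posSemidef {t : ℝ} (ht : 0 ≤ t) :
    (riccProjFlow A R S π t Q).PosSemidef := by
  have hπQ := h.positive Q hQ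
  obtain ⟨X, x0, xu, hX⟩ := exists_adjoint (A := A) hR hS hπQ
  have hwp := (isWellPosed_riccProj h hR hS hQ).1
  refine posSemidef_of_lyapunov x0 xu hX (V := fun t => riccProjFlow A R S π t Q)
    (N := fun t => R + riccFlow A R S t (π Q) * S * riccFlow A R S t (π Q))
    (fun t ht => ?_) (fun t ht => ?_) (fun t ht => ?_) ?_ ht
  · refine (hwp.2 t ht).congr_deriv ?_
    change riccProj A R S π (riccProjFlow A R S π t Q) = _
    rw [riccProj, map_riccProjFlow h hR hS hQ ht]
    abel
  · exact hR.posSemidef.add (posSemidef_mul_mul_self hS (riccFlow_transpose hR hS hπQ ht))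
  · rw [riccProjFlow_eq h hR hS hQ ht]
    simp only [Matrix.transpose_add, Matrix.transpose_mul, Matrix.transpose_transpose,
      Matrix.transpose_sub, transpose_eq_of_posSemidef hQ, transpose_eq_of_posSemidef hπQ,
      riccFlow_transpose hR hS hπQ ht, mul_assoc]
  · change (odeFlow _ Q 0).PosSemidef
    rw [hwp.1]
    exact hQ

end Model

/-! ### Exponential estimates -/

/-- The decay of the transition matrices, with a non-negative prefactor. -/
lemma exists_nonneg_prefactor {A R S : SqMat r} {ν : ℝ} (h : IsTransitionRate A R S ν) :
    ∃ K : ℝ → ℝ, Monotone K ∧ (∀ a, 0 ≤ K a) ∧ ∀ Q : SqMat r, Q.PosSemidef → ∀ t : ℝ, 0 ≤ t →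
      ‖transMat A R S t Q‖ ≤ K ‖Q‖ * Real.exp (-2 * ν * t) := by
  obtain ⟨κ, hκ, hle⟩ := h
  refine ⟨fun a => max (κ a) 0, fun a b hab => max_le_max_right 0 (hκ hab),
    fun a => le_max_right _ _, fun Q hQ t ht => (hle Q hQ t ht).trans ?_⟩
  gcongr
  exact le_max_left _ _

section Estimates

variable {A R S : SqMat r} (hR : R.PosDef) (hS : S.PosSemidef) {ν : ℝ} {K : ℝ → ℝ}
  (hK : ∀ Q : SqMat r, Q.PosSemidef → ∀ t : ℝ, 0 ≤ t →
      ‖transMat A R S t Q‖ ≤ K ‖Q‖ * Real.exp (-2 * ν * t))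
include hK

lemma norm_transport_le {Q₁ Q₂ : SqMat r} (h₁ : Q₁.PosSemidef) (h₂ : Q₂.PosSemidef) (D : SqMat r)
    {t : ℝ} (ht : 0 ≤ t) : ‖transMat A R S t Q₂ * D * (transMat A R S t Q₁)ᵀ‖ ≤
      K ‖Q₂‖ * K ‖Q₁‖ * Real.exp (-4 * ν * t) * ‖D‖ := by
  have b1 := hK Q₁ h₁ t ht
  have b2 := hK Q₂ h₂ t ht
  have e : Real.exp (-4 * ν * t) = Real.exp (-2 * ν * t) * Real.exp (-2 * ν * t) := by
    rw [← Real.exp_add]; ring_nf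
  calc _ ≤ ‖transMat A R S t Q₂‖ * ‖D‖ * ‖transMat A R S t Q₁‖ := norm_mul_mul_transpose_le _ _ _
    _ ≤ (K ‖Q₂‖ * Real.exp (-2 * ν * t)) * ‖D‖ * (K ‖Q₁‖ * Real.exp (-2 * ν * t)) :=
        mul_le_mul (mul_le_mul_of_nonneg_right b2 (norm_nonneg _)) b1 (norm_nonneg _)
          (mul_nonneg ((norm_nonneg _).trans b2) (norm_nonneg _))
    _ = _ := by rw [e]; ring

include hR hS

lemma norm_riccFlow_sub_le {Q₁ Q₂ : SqMat r} (h₁ : Q₁.PosSemidef) (h₂ : Q₂.PosSemidef)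
    {t : ℝ} (ht : 0 ≤ t) : ‖riccFlow A R S t Q₂ - riccFlow A R S t Q₁‖ ≤
      K ‖Q₂‖ * K ‖Q₁‖ * Real.exp (-4 * ν * t) * ‖Q₂ - Q₁‖ := by
  rw [riccFlow_sub hR hS h₁ h₂ ht]
  exact norm_transport_le hK h₁ h₂ _ ht

/-- Lipschitz dependence of the transition matrices on the initial matrix, through the bounded
Gramian `G = ∫₀ᵗ E_s(Q₁)ᵀ S E_s(Q₁) ds`. -/
lemma exists_transMat_sub (hν : 0 < ν) {Q₁ Q₂ : SqMat r} (h₁ : Q₁.PosSemidef)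
    (h₂ : Q₂.PosSemidef) {t : ℝ} (ht : 0 ≤ t) :
    ∃ G : SqMat r, ‖G‖ ≤ K ‖Q₁‖ ^ 2 * ‖S‖ / (4 * ν) ∧
      transMat A R S t Q₁ - transMat A R S t Q₂ = transMat A R S t Q₂ * (Q₂ - Q₁) * G := by
  -- freezing time at `0` on the negative axis makes the integrand continuous on `ℝ`
  set N : ℝ → SqMat r := fun s =>
    (transMat A R S (max s 0) Q₁)ᵀ * S * transMat A R S (max s 0) Q₁ with hN
  have cE : Continuous fun s => transMat A R S (max s 0) Q₁ := by
    have h1 : ContinuousOn (fun s => transMat A R S s Q₁) (Set.Ici 0) := fun s hs =>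
      (transMat_hasDeriv hR hS h₁ hs).continuousWithinAt
    exact h1.comp_continuous (by fun_prop) fun s => le_max_right s 0
  have cN : Continuous N := by
    have : Continuous fun s => (transMat A R S (max s 0) Q₁)ᵀ :=
      (LinearMap.continuous_of_finiteDimensional (Matrix.transposeLinearEquiv (Fin r) (Fin r) ℝ
        ℝ).toLinearMap).comp cE
    fun_prop
  set G : ℝ → SqMat r := fun t => ∫ s in (0 : ℝ)..t, N s with hG
  have hGd : ∀ t, HasDerivAt G (N t) t := fun t =>
    intervalIntegral.integral_hasDerivAt_right (cN.intervalIntegrable 0 t)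
      (cN.stronglyMeasurableAtFilter _ _) cN.continuousAt
  have hG0 : G 0 = 0 := intervalIntegral.integral_same
  have hNle : ∀ s, 0 ≤ s → ‖N s‖ ≤ K ‖Q₁‖ ^ 2 * ‖S‖ * Real.exp (-(4 * ν) * s) := fun s hs => by
    simp only [hN, max_eq_left hs]
    have b1 := hK Q₁ h₁ s hs
    have e : Real.exp (-(4 * ν) * s) = Real.exp (-2 * ν * s) * Real.exp (-2 * ν * s) := by
      rw [← Real.exp_add]; ring_nf
    refine (norm_mul_mul_le _ _ _).trans ?_
    rw [norm_transpose]
    calc _ ≤ (K ‖Q₁‖ * Real.exp (-2 * ν * s)) * ‖S‖ * (K ‖Q₁‖ * Real.exp (-2 * ν * s)) :=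
          mul_le_mul (mul_le_mul_of_nonneg_right b1 (norm_nonneg _)) b1 (norm_nonneg _)
            (mul_nonneg ((norm_nonneg _).trans b1) (norm_nonneg _))
      _ = _ := by rw [e]; ring
  refine ⟨G t, ?_, ?_⟩
  · set b := K ‖Q₁‖ ^ 2 * ‖S‖ / (4 * ν) with hb
    have hb0 : 0 ≤ b := by positivity
    have hBd : ∀ s, HasDerivAt (fun s => b * (1 - Real.exp (-(4 * ν) * s)))
        (K ‖Q₁‖ ^ 2 * ‖S‖ * Real.exp (-(4 * ν) * s)) s := fun s => by
      have := ((((hasDerivAt_id s).const_mul (-(4 * ν))).exp).const_sub 1).const_mul b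
      simp only [id_eq, mul_one] at this
      refine this.congr_deriv ?_
      rw [hb]; field_simp
    have := image_norm_le_of_norm_deriv_right_le_deriv_boundary (f := G) (f' := N) (a := 0)
      (b := t) (fun s _ => (hGd s).continuousAt.continuousWithinAt)
      (fun s _ => (hGd s).hasDerivWithinAt) (B := fun s => b * (1 - Real.exp (-(4 * ν) * s)))
      (by simp [hG0]) hBd (fun s hs => hNle s hs.1) ⟨ht, le_rfl⟩
    refine this.trans ?_
    have := Real.exp_pos (-(4 * ν) * t)
    nlinarith
  · have c₂ := riccFlow_continuousOn (A := A) hR hS h₂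
    have key := eq_zero_of_lyapunov (B := fun t => A - riccFlow A R S t Q₂ * S) (D := fun _ => 0)
      (V := fun t => transMat A R S t Q₁ - transMat A R S t Q₂ -
        transMat A R S t Q₂ * (Q₂ - Q₁) * G t) (by fun_prop) (by fun_prop) (fun t ht => ?_)
      (by simp [transMat_zero hR hS h₁, transMat_zero hR hS h₂, hG0]) ht
    · exact sub_eq_zero.1 key
    · have e₁ := transMat_hasDeriv (A := A) hR hS h₁ ht
      have e₂ := transMat_hasDeriv (A := A) hR hS h₂ ht
      refine ((e₁.fun_sub e₂).fun_sub ((e₂.mul_const (Q₂ - Q₁)).fun_mul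
        (hGd t).hasDerivWithinAt)).congr_deriv ?_
      have e3 := riccFlow_sub (A := A) hR hS h₁ h₂ ht
      have e4 : transMat A R S t Q₂ * (Q₂ - Q₁) * N t =
          (riccFlow A R S t Q₂ - riccFlow A R S t Q₁) * S * transMat A R S t Q₁ := by
        rw [e3]
        simp only [hN, max_eq_left ht, mul_assoc]
      rw [e4]
      noncomm_ring

end Estimates

/-! ### Consequences for the projected flow -/

section Estimates

variable {A R S : SqMat r} (hR : R.PosDef) (hS : S.PosSemidef) {ν : ℝ} {K : ℝ → ℝ}
  (hK : ∀ Q : SqMat r, Q.PosSemidef → ∀ t : ℝ, 0 ≤ t →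
      ‖transMat A R S t Q‖ ≤ K ‖Q‖ * Real.exp (-2 * ν * t))
include hR hS hK

/-- Contraction of the projected flow. Only `π(Q₂) - π(Q₁)` enters through the Riccati flow and
through the variation of the transition matrices. -/
lemma norm_riccProjFlow_sub_le {𝓑 : NonUnitalSubring (SqMat r)} {π : SqMat r →ₗ[ℝ] SqMat r}
    (h : IsOrthogonalProjectionModel A R S 𝓑 π) (hν : 0 < ν) {Q₁ Q₂ : SqMat r}
    (h₁ : Q₁.PosSemidef) (h₂ : Q₂.PosSemidef) {k₁ k₂ : ℝ} (hk₁ : K ‖π Q₁‖ ≤ k₁)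
    (hk₂ : K ‖π Q₂‖ ≤ k₂) (hK0 : ∀ a, 0 ≤ K a) {t : ℝ} (ht : 0 ≤ t) :
    ‖riccProjFlow A R S π t Q₂ - riccProjFlow A R S π t Q₁‖ ≤
      (k₁ * k₂ + k₂ ^ 2 + (k₂ ^ 2 + k₁ * k₂) * (k₁ ^ 2 * ‖S‖ / (4 * ν)) * ‖Q₁ - π Q₁‖) *
        Real.exp (-2 * ν * t) * (‖π Q₂ - π Q₁‖ + Real.exp (-2 * ν * t) * ‖Q₂ - Q₁‖) := by
  have p₁ := h.positive Q₁ h₁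
  have p₂ := h.positive Q₂ h₂
  obtain ⟨G, hG, hGe⟩ := exists_transMat_sub hR hS hK hν p₁ p₂ ht
  have hk₁0 : 0 ≤ k₁ := (hK0 _).trans hk₁
  have hk₂0 : 0 ≤ k₂ := (hK0 _).trans hk₂
  set g := k₁ ^ 2 * ‖S‖ / (4 * ν) with hg
  have hg0 : 0 ≤ g := by positivity
  have hGg : ‖G‖ ≤ g := hG.trans (by
    rw [hg]
    have := hK0 ‖π Q₁‖
    gcongr)
  have bY := norm_riccFlow_sub_le hR hS hK p₁ p₂ ht
  have b₁ := hK _ p₁ t ht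
  have b₂ := hK _ p₂ t ht
  have ee : Real.exp (-4 * ν * t) = Real.exp (-2 * ν * t) ^ 2 := by
    rw [← Real.exp_nat_mul]; congr 1; push_cast; ring
  have he1 : Real.exp (-2 * ν * t) ≤ 1 := Real.exp_le_one_iff.2 (by nlinarith)
  rw [riccProjFlow_eq h hR hS h₁ ht, riccProjFlow_eq h hR hS h₂ ht]
  rw [ee] at bY
  revert bY b₁ b₂ he1 hGe
  have he0 := Real.exp_pos (-2 * ν * t)
  revert he0
  generalize Real.exp (-2 * ν * t) = e
  generalize transMat A R S t (π Q₁) = E₁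
  generalize transMat A R S t (π Q₂) = E₂
  generalize riccFlow A R S t (π Q₁) = Y₁
  generalize riccFlow A R S t (π Q₂) = Y₂
  intro he0 hGe bY b₁ b₂ he1
  set D₁ := Q₁ - π Q₁
  set D₂ := Q₂ - π Q₂
  set p := ‖π Q₂ - π Q₁‖
  set q := ‖Q₂ - Q₁‖
  have hD : ‖D₂ - D₁‖ ≤ q + p := by
    have : D₂ - D₁ = (Q₂ - Q₁) - (π Q₂ - π Q₁) := by simp only [D₁, D₂]; abel
    rw [this]; exact norm_sub_le _ _
  have c₁ : ‖E₁‖ ≤ k₁ * e := b₁.trans (by gcongr)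
  have c₂ : ‖E₂‖ ≤ k₂ * e := b₂.trans (by gcongr)
  have cY : ‖Y₂ - Y₁‖ ≤ k₂ * k₁ * e ^ 2 * p := bY.trans (by
    have := hK0 ‖π Q₁‖
    gcongr)
  have cE : ‖E₁ - E₂‖ ≤ k₂ * e * p * g := by
    rw [hGe]
    exact (norm_mul_mul_le _ _ _).trans (by gcongr)
  have split : Y₂ + E₂ * D₂ * E₂ᵀ - (Y₁ + E₁ * D₁ * E₁ᵀ) = (Y₂ - Y₁) +
      E₂ * (D₂ - D₁) * E₂ᵀ - (E₁ - E₂) * D₁ * E₂ᵀ - E₁ * D₁ * (E₁ - E₂)ᵀ := by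
    rw [Matrix.transpose_sub]; noncomm_ring
  rw [split]
  have d1 : ‖E₂ * (D₂ - D₁) * E₂ᵀ‖ ≤ (k₂ * e) * (q + p) * (k₂ * e) :=
    (norm_mul_mul_transpose_le _ _ _).trans (by gcongr)
  have d2 : ‖(E₁ - E₂) * D₁ * E₂ᵀ‖ ≤ (k₂ * e * p * g) * ‖D₁‖ * (k₂ * e) :=
    (norm_mul_mul_transpose_le _ _ _).trans (by gcongr)
  have d3 : ‖E₁ * D₁ * (E₁ - E₂)ᵀ‖ ≤ (k₁ * e) * ‖D₁‖ * (k₂ * e * p * g) :=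
    (norm_mul_mul_transpose_le _ _ _).trans (by gcongr)
  refine (norm_sub_le_of_le (norm_sub_le_of_le (norm_add_le_of_le cY d1) d2) d3).trans ?_
  have hp0 : 0 ≤ p := ContinuousLinearMap.opNorm_nonneg _
  have hq0 : 0 ≤ q := norm_nonneg _
  have hd0 : 0 ≤ ‖D₁‖ := norm_nonneg _
  have hM : 0 ≤ k₁ * k₂ + k₂ ^ 2 + (k₂ ^ 2 + k₁ * k₂) * g * ‖D₁‖ := by positivity
  have h5 : e ^ 2 * p ≤ e * p := by nlinarith [mul_nonneg he0.le hp0]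
  have h6 := mul_le_mul_of_nonneg_left h5 hM
  have h7 : 0 ≤ (k₁ * k₂ + (k₂ ^ 2 + k₁ * k₂) * g * ‖D₁‖) * (e ^ 2 * q) := by positivity
  nlinarith

/-- Every Riccati trajectory converges to a stationary matrix. -/
lemma tendsto_riccFlow {P Q : SqMat r} (hν : 0 < ν) (hP : P.PosSemidef) (h0 : ricc A R S P = 0)
    (hQ : Q.PosSemidef) :
    Filter.Tendsto (fun t => riccFlow A R S t Q) Filter.atTop (nhds P) := by
  rw [tendsto_iff_norm_sub_tendsto_zero]
  refine squeeze_zero' (.of_forall fun _ => norm_nonneg _)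
    (Filter.eventually_atTop.2 ⟨0, fun t ht => ?_⟩)
    (g := fun t => K ‖Q‖ * K ‖P‖ * Real.exp (-4 * ν * t) * ‖Q - P‖) ?_
  · have := norm_riccFlow_sub_le hR hS hK hP hQ ht
    rwa [riccFlow_eq_self hR hS hP h0 ht] at this
  · have h1 : Filter.Tendsto (fun t => Real.exp (-4 * ν * t)) Filter.atTop (nhds 0) :=
      Real.tendsto_exp_atBot.comp
        (Filter.tendsto_id.const_mul_atTop_of_neg (by linarith : -4 * ν < 0))
    simpa using (h1.const_mul (K ‖Q‖ * K ‖P‖)).mul_const ‖Q - P‖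

lemma map_stationary {𝓑 : NonUnitalSubring (SqMat r)} {π : SqMat r →ₗ[ℝ] SqMat r}
    (h : IsOrthogonalProjectionModel A R S 𝓑 π) {P : SqMat r} (hν : 0 < ν) (hP : P.PosSemidef)
    (h0 : ricc A R S P = 0) : π P = P := by
  have z : (0 : SqMat r).PosSemidef := Matrix.PosSemidef.zero
  have h1 := tendsto_riccFlow hR hS hK hν hP h0 z
  have h2 := ((LinearMap.continuous_of_finiteDimensional π).tendsto P).comp h1
  refine tendsto_nhds_unique h2 (h1.congr' ?_)
  filter_upwards [Filter.eventually_ge_atTop 0] with t ht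
  exact (map_riccFlow h hR hS z (map_zero π) ht).symm

lemma riccProjFlow_stationary {𝓑 : NonUnitalSubring (SqMat r)} {π : SqMat r →ₗ[ℝ] SqMat r}
    (h : IsOrthogonalProjectionModel A R S 𝓑 π) {P : SqMat r} (hν : 0 < ν) (hP : P.PosSemidef)
    (h0 : ricc A R S P = 0) {t : ℝ} (ht : 0 ≤ t) : riccProjFlow A R S π t P = P := by
  rw [riccProjFlow_eq h hR hS hP ht, map_stationary hR hS hK h hν hP h0, sub_self, mul_zero,
    zero_mul, add_zero, riccFlow_eq_self hR hS hP h0 ht]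

/-- A fixed point of `φ^π_t` is fixed by `φ^π_{nt}` for all `n`, whereas `φ^π_s(X)` converges to
`P` as `s → ∞`. -/
lemma eq_of_riccProjFlow_eq {𝓑 : NonUnitalSubring (SqMat r)} {π : SqMat r →ₗ[ℝ] SqMat r}
    (h : IsOrthogonalProjectionModel A R S 𝓑 π) {P X : SqMat r} (hν : 0 < ν)
    (hP : P.PosSemidef) (h0 : ricc A R S P = 0) (hX : X.PosSemidef) {t : ℝ} (ht : 0 < t)
    (hfix : riccProjFlow A R S π t X = X) : X = P := by
  have hpX := h.positive X hX
  have hlim : Filter.Tendsto (fun s => riccProjFlow A R S π s X) Filter.atTop (nhds P) := by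
    have h1 : Filter.Tendsto (fun t => Real.exp (-4 * ν * t)) Filter.atTop (nhds 0) :=
      Real.tendsto_exp_atBot.comp
        (Filter.tendsto_id.const_mul_atTop_of_neg (by linarith : -4 * ν < 0))
    have h2 : Filter.Tendsto
        (fun s => transMat A R S s (π X) * (X - π X) * (transMat A R S s (π X))ᵀ)
        Filter.atTop (nhds 0) := by
      refine squeeze_zero_norm' (Filter.eventually_atTop.2 ⟨0, fun s hs =>
        norm_transport_le hK hpX hpX (X - π X) hs⟩) ?_
      simpa using (h1.const_mul (K ‖π X‖ * K ‖π X‖)).mul_const ‖X - π X‖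
    have h3 := (tendsto_riccFlow hR hS hK hν hP h0 hpX).add h2
    rw [add_zero] at h3
    refine h3.congr' ?_
    filter_upwards [Filter.eventually_ge_atTop 0] with s hs
    exact (riccProjFlow_eq h hR hS hX hs).symm
  have hiter : ∀ n : ℕ, riccProjFlow A R S π (n * t) X = X := fun n => by
    induction n with
    | zero =>
      rw [Nat.cast_zero, zero_mul]
      exact (isWellPosed_riccProj h hR hS hX).1.1
    | succ n ih =>
      have hw := isWellPosed_riccProj h hR hS hX
      have h1 := odeFlow_add (F := riccProj A R S π) (Q := X) (s := n * t) (t := t)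
        (by positivity) ht.le hw (by
          change IsWellPosed _ (riccProjFlow A R S π (n * t) X)
          rw [ih]; exact hw)
      change riccProjFlow A R S π (t + n * t) X =
        riccProjFlow A R S π t (riccProjFlow A R S π (n * t) X) at h1
      rw [ih, hfix] at h1
      rw [Nat.cast_succ, add_mul, one_mul, add_comm]
      exact h1
  have h4 := hlim.comp (tendsto_natCast_atTop_atTop.atTop_mul_const ht)
  refine tendsto_nhds_unique (tendsto_const_nhds.congr fun n => ?_) h4
  exact (hiter n).symm

end Estimates

end RiccatiStability

open RiccatiStability

theorem theorem2p13 (r m : ℕ) (A R : SqMat r) (C : Matrix (Fin m) (Fin r) ℝ)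
    (Sg : Matrix (Fin m) (Fin m) ℝ) (hR : R.PosDef) (hSg : Sg.PosDef)
    (hobs : (observabilityMatrix A C).rank = r)
    (S : SqMat r) (hS : S = C.transpose * Sg⁻¹ * C) :
    -- the Riccati semigroup and its transition matrices are well defined
    (∀ Q : SqMat r, Q.PosSemidef →
      IsWellPosed (fun _ => ricc A R S) Q ∧
      (∀ t : ℝ, 0 ≤ t → (riccFlow A R S t Q).PosSemidef) ∧
      IsWellPosed (transDrift A R S Q) 1) ∧
    -- `P` is the positive definite solution of the algebraic Riccati equation
    ∃ P : SqMat r, P.PosDef ∧ ricc A R S P = 0 ∧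
      (∀ P' : SqMat r, P'.PosDef → ricc A R S P' = 0 → P' = P) ∧
      -- existence of a rate, which depends on `(A, R, S)` only
      (∃ ν : ℝ, 0 < ν ∧ IsTransitionRate A R S ν) ∧
      -- the projected semigroup is well defined and has exactly one fixed point
      (∀ (𝓑 : NonUnitalSubring (SqMat r)) (π : SqMat r →ₗ[ℝ] SqMat r),
        IsOrthogonalProjectionModel A R S 𝓑 π →
        (∀ Q : SqMat r, Q.PosSemidef →
          IsWellPosed (fun _ => riccProj A R S π) Q ∧
          ∀ t : ℝ, 0 ≤ t → (riccProjFlow A R S π t Q).PosSemidef) ∧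
        ∃ Pπ : SqMat r, Pπ.PosSemidef ∧
          (∀ t : ℝ, 0 ≤ t → riccProjFlow A R S π t Pπ = Pπ) ∧
          (∀ t : ℝ, 0 < t → ∀ X : SqMat r, X.PosSemidef →
            riccProjFlow A R S π t X = X → X = Pπ) ∧
          π Pπ = P ∧ Pπ = P) ∧
      -- the exponential estimates
      ∀ ν : ℝ, 0 < ν → IsTransitionRate A R S ν →
        ∃ κφ : ℝ → ℝ → ℝ,
          (∀ a a' b b' : ℝ, a ≤ a' → b ≤ b' → κφ a b ≤ κφ a' b') ∧
          (∀ Q₁ Q₂ : SqMat r, Q₁.PosSemidef → Q₂.PosSemidef → ∀ t : ℝ, 0 ≤ t →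
            ‖riccFlow A R S t Q₂ - riccFlow A R S t Q₁‖ ≤
              κφ ‖Q₁‖ ‖Q₂‖ * Real.exp (-2 * ν * t) * ‖Q₂ - Q₁‖) ∧
          ∀ (𝓑 : NonUnitalSubring (SqMat r)) (π : SqMat r →ₗ[ℝ] SqMat r),
            IsOrthogonalProjectionModel A R S 𝓑 π →
            ∃ κ : ℝ → ℝ → ℝ,
              (∀ Q₁ Q₂ : SqMat r, Q₁.PosSemidef → Q₂.PosSemidef → ∀ t : ℝ, 0 ≤ t →
                ‖riccProjFlow A R S π t Q₂ - riccProjFlow A R S π t Q₁‖ ≤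
                  κ ‖Q₁‖ ‖Q₂‖ * Real.exp (-2 * ν * t) *
                    (‖π Q₂ - π Q₁‖ + Real.exp (-2 * ν * t) * ‖Q₂ - Q₁‖)) ∧
              (∀ Q : SqMat r, Q.PosSemidef → ∀ t : ℝ, 0 ≤ t →
                ‖π (riccProjFlow A R S π t Q) - riccProjFlow A R S π t Q‖ ≤
                  κ ‖Q‖ ‖π Q‖ * Real.exp (-4 * ν * t) * ‖π Q - Q‖) ∧
              (∀ Q : SqMat r, Q.PosSemidef → ∀ t : ℝ, 0 ≤ t →
                ‖riccProjFlow A R S π t Q - riccFlow A R S t (π Q)‖ ≤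
                  κ ‖Q‖ ‖π Q‖ * Real.exp (-4 * ν * t) * ‖Q - π Q‖) ∧
              (∀ Q : SqMat r, Q.PosSemidef → ∀ t : ℝ, 0 ≤ t →
                ‖riccProjFlow A R S π t Q - riccFlow A R S t Q‖ ≤
                  Real.exp (-2 * ν * t) *
                    (κφ ‖Q‖ ‖π Q‖ + κ ‖Q‖ ‖π Q‖ * Real.exp (-2 * ν * t)) *
                    ‖Q - π Q‖) ∧
              ∃ c : ℝ → ℝ, ∀ Q : SqMat r, Q.PosSemidef → ∀ t : ℝ, 0 ≤ t →
                ‖riccProjFlow A R S π t Q - riccFlow A R S t Q‖ ≤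
                  c ‖Q‖ * Real.exp (-2 * ν * t) * ‖Q - π Q‖ := by
  have hS' : S.PosSemidef := by
    rw [hS]
    simpa [Matrix.conjTranspose_eq_transpose_of_trivial] using
      hSg.inv.posSemidef.conjTranspose_mul_mul_same C
  have hSC : ∀ x, x ⬝ᵥ S *ᵥ x = 0 → C *ᵥ x = 0 := fun x hx => by
    by_contra hne
    have h1 := (Matrix.posDef_iff_dotProduct_mulVec.1 hSg.inv).2 hne
    rw [hS, Matrix.mul_assoc, ← Matrix.mulVec_mulVec, ← Matrix.mulVec_mulVec,
      Matrix.dotProduct_mulVec, Matrix.vecMul_transpose] at hx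
    rw [star_trivial, hx] at h1
    exact lt_irrefl _ h1
  obtain ⟨P, hP, hP0, hlim⟩ := exists_stationary hobs hS' hSC hR
  obtain ⟨ν₀, hν₀, hrate⟩ := exists_transitionRate hR hS' hP hP0 hlim
  obtain ⟨K₀, -, -, hK₀⟩ := exists_nonneg_prefactor hrate
  refine ⟨fun Q hQ => ⟨isWellPosed_ricc A hR hS' hQ,
    fun t ht => riccFlow_posSemidef hR hS' hQ ht, isWellPosed_trans hR hS' hQ⟩,
    P, hP, hP0, fun P' hP' h0 => ?_, ⟨ν₀, hν₀, hrate⟩, fun 𝓑 π h => ⟨fun Q hQ =>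
    ⟨isWellPosed_riccProj h hR hS' hQ, fun t ht => riccProjFlow_posSemidef h hR hS' hQ ht⟩,
    P, hP.posSemidef, fun t ht => riccProjFlow_stationary hR hS' hK₀ h hν₀ hP.posSemidef hP0 ht,
    fun t ht X hX hfix => eq_of_riccProjFlow_eq hR hS' hK₀ h hν₀ hP.posSemidef hP0 hX ht hfix,
    map_stationary hR hS' hK₀ h hν₀ hP.posSemidef hP0, rfl⟩, ?_⟩
  · refine tendsto_nhds_unique
      (tendsto_riccFlow hR hS' hK₀ hν₀ hP'.posSemidef h0 Matrix.PosSemidef.zero)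
      (tendsto_riccFlow hR hS' hK₀ hν₀ hP.posSemidef hP0 Matrix.PosSemidef.zero)
  intro ν hν hrate
  obtain ⟨K, hKm, hK0, hK⟩ := exists_nonneg_prefactor hrate
  have he : ∀ t : ℝ, 0 ≤ t → Real.exp (-4 * ν * t) ≤ Real.exp (-2 * ν * t) := fun t ht =>
    Real.exp_le_exp.2 (by nlinarith [mul_nonneg hν.le ht])
  have hφ : ∀ Q₁ Q₂ : SqMat r, Q₁.PosSemidef → Q₂.PosSemidef → ∀ t : ℝ, 0 ≤ t →
      ‖riccFlow A R S t Q₂ - riccFlow A R S t Q₁‖ ≤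
        K ‖Q₁‖ * K ‖Q₂‖ * Real.exp (-2 * ν * t) * ‖Q₂ - Q₁‖ := fun Q₁ Q₂ h₁ h₂ t ht => by
    refine (norm_riccFlow_sub_le hR hS' hK h₁ h₂ ht).trans ?_
    have := mul_nonneg (hK0 ‖Q₁‖) (hK0 ‖Q₂‖)
    rw [mul_comm (K ‖Q₂‖)]
    have he' := he t ht
    gcongr
  refine ⟨fun a b => K a * K b, fun a a' b b' ha hb =>
    mul_le_mul (hKm ha) (hKm hb) (hK0 _) (hK0 _), hφ, fun 𝓑 π h => ?_⟩
  set p := ‖LinearMap.toContinuousLinearMap π‖ with hp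
  have hp0 : 0 ≤ p := ContinuousLinearMap.opNorm_nonneg _
  have hpQ : ∀ Q : SqMat r, ‖π Q‖ ≤ p * ‖Q‖ := norm_map_le π
  have hpK : ∀ Q : SqMat r, K ‖π Q‖ ≤ K (p * ‖Q‖) := fun Q => hKm (hpQ Q)
  -- the transported part of the explicit solution controls all but the first estimate
  have hΔ : ∀ Q : SqMat r, Q.PosSemidef → ∀ t : ℝ, 0 ≤ t →
      ‖riccProjFlow A R S π t Q - riccFlow A R S t (π Q)‖ ≤
        K ‖π Q‖ ^ 2 * Real.exp (-4 * ν * t) * ‖Q - π Q‖ := fun Q hQ t ht => by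
    rw [riccProjFlow_eq h hR hS' hQ ht, add_sub_cancel_left, sq]
    exact norm_transport_le hK (h.positive Q hQ) (h.positive Q hQ) _ ht
  -- `κ₁` bounds the constant of `norm_riccProjFlow_sub_le` by `‖π(Q)‖ ≤ p ‖Q‖`; it depends on
  -- `π` through `p`, whereas `κφ` does not
  set κ₁ : ℝ → ℝ → ℝ := fun a b => K (p * a) * K (p * b) + K (p * b) ^ 2 +
    (K (p * b) ^ 2 + K (p * a) * K (p * b)) * (K (p * a) ^ 2 * ‖S‖ / (4 * ν)) *
      ((1 + p) * a) with hκ₁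
  have hκ₁0 : ∀ a b, 0 ≤ a → 0 ≤ κ₁ a b := fun a b ha => by
    have h1 := hK0 (p * a)
    have h2 := hK0 (p * b)
    positivity
  have hκ : ∀ Q : SqMat r, K ‖π Q‖ ^ 2 ≤ κ₁ ‖Q‖ ‖π Q‖ + K ‖π Q‖ ^ 2 := fun Q =>
    le_add_of_nonneg_left (hκ₁0 _ _ (norm_nonneg Q))
  have hΔκ : ∀ Q : SqMat r, Q.PosSemidef → ∀ t : ℝ, 0 ≤ t →
      ‖riccProjFlow A R S π t Q - riccFlow A R S t (π Q)‖ ≤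
        (κ₁ ‖Q‖ ‖π Q‖ + K ‖π Q‖ ^ 2) * Real.exp (-4 * ν * t) * ‖Q - π Q‖ := fun Q hQ t ht =>
    (hΔ Q hQ t ht).trans (by
      have := hκ Q
      gcongr)
  refine ⟨fun a b => κ₁ a b + K b ^ 2, fun Q₁ Q₂ h₁ h₂ t ht => ?_, fun Q hQ t ht => ?_, hΔκ,
    fun Q hQ t ht => ?_, fun a => K a * K (p * a) + K (p * a) ^ 2, fun Q hQ t ht => ?_⟩
  · have h1 := norm_riccProjFlow_sub_le hR hS' hK h hν h₁ h₂ (hpK Q₁) (hpK Q₂) hK0 ht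
    refine h1.trans ?_
    have hD : ‖Q₁ - π Q₁‖ ≤ (1 + p) * ‖Q₁‖ := by
      have := norm_sub_le Q₁ (π Q₁)
      linarith [hpQ Q₁]
    have h2 := hK0 (p * ‖Q₁‖)
    have h3 := hK0 (p * ‖Q₂‖)
    have h4 : K (p * ‖Q₁‖) * K (p * ‖Q₂‖) + K (p * ‖Q₂‖) ^ 2 +
        (K (p * ‖Q₂‖) ^ 2 + K (p * ‖Q₁‖) * K (p * ‖Q₂‖)) *
          (K (p * ‖Q₁‖) ^ 2 * ‖S‖ / (4 * ν)) * ‖Q₁ - π Q₁‖ ≤ κ₁ ‖Q₁‖ ‖Q₂‖ := by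
      simp only [hκ₁]
      gcongr
    have h5 := h4.trans (le_add_of_nonneg_right (sq_nonneg (K ‖Q₂‖)))
    gcongr
  · rw [map_riccProjFlow h hR hS' hQ ht, norm_sub_rev, norm_sub_rev (π Q)]
    exact hΔκ Q hQ t ht
  · have h1 := hΔκ Q hQ t ht
    have h2 := hφ Q (π Q) hQ (h.positive Q hQ) t ht
    have h3 := norm_add_le (riccProjFlow A R S π t Q - riccFlow A R S t (π Q))
      (riccFlow A R S t (π Q) - riccFlow A R S t Q)
    rw [sub_add_sub_cancel] at h3
    rw [norm_sub_rev (π Q)] at h2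
    refine (h3.trans (add_le_add h1 h2)).trans (le_of_eq ?_)
    have e : Real.exp (-4 * ν * t) = Real.exp (-2 * ν * t) * Real.exp (-2 * ν * t) := by
      rw [← Real.exp_add]; ring_nf
    rw [e]
    ring
  · have h1 := hΔ Q hQ t ht
    have h2 := hφ Q (π Q) hQ (h.positive Q hQ) t ht
    have h3 := norm_add_le (riccProjFlow A R S π t Q - riccFlow A R S t (π Q))
      (riccFlow A R S t (π Q) - riccFlow A R S t Q)
    rw [sub_add_sub_cancel] at h3
    rw [norm_sub_rev (π Q)] at h2
    have b1 : K ‖π Q‖ ^ 2 * Real.exp (-4 * ν * t) * ‖Q - π Q‖ ≤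
        K (p * ‖Q‖) ^ 2 * Real.exp (-2 * ν * t) * ‖Q - π Q‖ := by
      have h4 := hK0 ‖π Q‖
      have h5 := hpK Q
      have h6 := he t ht
      gcongr
    have b2 : K ‖Q‖ * K ‖π Q‖ * Real.exp (-2 * ν * t) * ‖Q - π Q‖ ≤
        K ‖Q‖ * K (p * ‖Q‖) * Real.exp (-2 * ν * t) * ‖Q - π Q‖ := by
      have h4 := hK0 ‖Q‖
      have h5 := hpK Q
      gcongr
    refine (h3.trans (add_le_add (h1.trans b1) (h2.trans b2))).trans (le_of_eq ?_)
    ring
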